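/- Let $d\ge 1$, let $\mathbf T^d=[-\pi,\pi]^d/\!\sim$ be the torus with Lebesgue measure, and let $|x|$ be the Euclidean torus distance from $x$ to $0$. Let $\mathfrak T\subseteq(-d,\infty)$ be a set of types that is bounded above and satisfies $\inf\mathfrak T>-d$. For $\mathfrak t\in\mathfrak T$ and $\varepsilon\in(0,1)$ let $K_{\mathfrak t,\varepsilon}:\mathbf T^d\to\mathbf R$ be measurable kernels with $$\sup_{\mathfrak t\in\mathfrak T}\ \sup_{\varepsilon\in(0,1)}\ \sup_{x\in\mathbf T^d}(|x|+\varepsilon)^{-\mathfrak t}\,|K_{\mathfrak t,\varepsilon}(x)|<\infty .$$ (If $\mathfrak T$ is finite, these uniformity conditions say just that $\mathfrak T\subseteq(-d,\infty)$ and that the bound holds for each type.) A typed Feynman diagram $\Gamma=(V,E,\mathfrak t)$ is a finite directed multigraph with a set $L\subseteq V$ of leaves and a map $\mathfrak t:E\to\mathfrak T$; an edge $e$ runs from $e_-$ to $e_+$. Put $V_\star=V\setminus L$, let $E_\star$ be the set of edges with both endpoints in $V_\star$, and $E_L=E\setminus E_\star$. It is a $2k$-Feynman diagram if $|L|=2k$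 and every leaf lies on exactly one edge (has graph degree one). For $\varphi\in C^\infty((\mathbf T^d)^L;\mathbf R)$ set $$\Pi_\varepsilon\Gamma(\varphi)=\int_{(\mathbf T^d)^L}\Big(\int_{(\mathbf T^d)^{V_\star}}\prod_{e\in E_\star}K_{\mathfrak t(e),\varepsilon}(x_{e_+}-x_{e_-})\prod_{e\in E_L}K_{\mathfrak t(e),\varepsilon}(x_{e_+}-x_{e_-})\,\mathrm dx_{V_\star}\Big)\varphi(x_L)\,\mathrm dx_L .$$ A subdiagram consists of a set $\overline V\subseteq V_\star$ and a set $\overline E\subseteq E_\star$ of edges with endpoints in $\overline V$; its degree is the sum, over its connected components $(V',E')$, of $d(|V'|-1)+\sum_{e\in E'}\mathfrak t(e)$. $\Gamma$ is non-negative if all its subdiagrams have degree $\ge 0$. Let $\mathcal T_{V_\star}$ be the set of Hepp trees over $V_\star$: rooted binary trees with leaf set $V_\star$ (every inner node has two unordered children). For an inner node $u$ of $T\in\mathcal T_{V_\star}$ let $V_u\subseteq V_\star$ be the set of leaves of $T$ below $u$, let $E_u$ be the set of edges of $\Gamma$ with both endpoints in $V_u$, let $\overline{\deg}(u)=d(|V_u|-1)+\sum_{e\in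 E_u}\mathfrak t(e)$, and let $\mathrm{Null}(T)$ be the number of inner nodes $u$ with $\overline{\deg}(u)=0$. Then there exists a constant $C>0$ such that for all $k\ge 0$, every non-negative $2k$-Feynman diagram $\Gamma$ with $V_\star\neq\emptyset$ and with $\mathfrak t(e)\in\mathbf Z$ for all $e\in E_\star$, every $\varepsilon\in(0,1)$ and every $\varphi\in C^\infty((\mathbf T^d)^L;\mathbf R)$, $$|\Pi_\varepsilon\Gamma(\varphi)|\le\|\varphi\|_\infty\,C^{|V_\star|+|E_\star|+2k}\sum_{T\in\mathcal T_{V_\star}}\Big(\max\big\{1,\log\tfrac1\varepsilon\big\}\Big)^{\mathrm{Null}(T)} .$$ -/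

import Mathlib

noncomputable section

namespace Feynman

/-- The `d`-dimensional torus `[-π, π]^d / ∼`; its `volume` is Lebesgue measure, of total
mass `(2π)^d`. -/
abbrev Torus (d : ℕ) : Type := Fin d → AddCircle (2 * Real.pi)

instance : Fact ((0 : ℝ) < 2 * Real.pi) := ⟨Real.two_pi_pos⟩

/-- `|x|`: the (Euclidean) distance on the torus between `x` and `0`. -/
def torusNorm {d : ℕ} (x : Torus d) : ℝ := Real.sqrt (∑ i, ‖x i‖ ^ 2)

/-- Smooth functions on `(𝐓^d)^I`: those whose periodic lift to `(ℝ^d)^I` is smooth. -/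
def IsSmooth {d : ℕ} {I : Type*} [Fintype I] (φ : (I → Torus d) → ℝ) : Prop :=
  ContDiff ℝ ((⊤ : ℕ∞) : WithTop ℕ∞)
    (fun y : I → Fin d → ℝ => φ (fun l i => (y l i : AddCircle (2 * Real.pi))))

/-- The supremum norm. -/
def supNorm {X : Type*} (φ : X → ℝ) : ℝ := ⨆ x, |φ x|

/-- A typed Feynman diagram: a directed multigraph with vertices `V` and edges `E` (so parallel
edges and self-loops are possible), each edge `e = (e₋, e₊)` running from `src e = e₋` to
`tgt e = e₊`, with a distinguished set of leaves and with a type from `𝔗` on each edge. -/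
structure Diagram (𝔗 : Set ℝ) (V E : Type*) where
  src : E → V
  tgt : E → V
  leaves : Finset V
  type : E → 𝔗

namespace Diagram

variable {𝔗 : Set ℝ} {V E : Type*} [Fintype V] [Fintype E] (Γ : Diagram 𝔗 V E)

open Classical in
/-- The inner vertices `V⋆ = V \ L`. -/
def inner : Finset V := Finset.univ.filter (fun v => v ∉ Γ.leaves)

open Classical in
/-- The inner edges `E⋆`, with both endpoints in `V⋆`. -/
def innerEdges : Finset E :=
  Finset.univ.filter (fun e => Γ.src e ∈ Γ.inner ∧ Γ.tgt e ∈ Γ.inner)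

open Classical in
/-- The legs `E_L = E \ E⋆`. -/
def legs : Finset E := Finset.univ.filter (fun e => e ∉ Γ.innerEdges)

open Classical in
/-- Graph degree of a vertex: number of outgoing plus number of incoming edges. -/
def vertexDegree (v : V) : ℕ :=
  (Finset.univ.filter (fun e => Γ.src e = v)).card +
    (Finset.univ.filter (fun e => Γ.tgt e = v)).card

/-- A diagram with `2k` legs: it has `2k` leaves and each leaf lies on exactly one edge. -/
def HasLegs (k : ℕ) : Prop :=
  Γ.leaves.card = 2 * k ∧ ∀ v ∈ Γ.leaves, Γ.vertexDegree v = 1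

/-! ### Degrees -/

/-- A subdiagram: some inner vertices together with some of the edges between them. -/
structure Subdiagram where
  verts : Finset V
  edges : Finset E
  verts_subset : verts ⊆ Γ.inner
  src_mem : ∀ e ∈ edges, Γ.src e ∈ verts
  tgt_mem : ∀ e ∈ edges, Γ.tgt e ∈ verts

variable {Γ} in
/-- The undirected simple graph on `V` underlying a subdiagram. -/
def Subdiagram.graph (S : Γ.Subdiagram) : SimpleGraph V :=
  SimpleGraph.fromRel (fun v w => ∃ e ∈ S.edges, Γ.src e = v ∧ Γ.tgt e = w)

open Classical in
variable {Γ} in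
/-- The degree of a subdiagram in dimension `d`: the sum, over its connected components, of
`d (number of vertices - 1) + sum of the types of the edges`. -/
def Subdiagram.deg (d : ℕ) (S : Γ.Subdiagram) : ℝ :=
  ∑ c ∈ S.verts.image S.graph.connectedComponentMk,
    ((d : ℝ) * (((S.verts.filter (fun v => S.graph.connectedComponentMk v = c)).card : ℝ) - 1) +
      ∑ e ∈ S.edges.filter (fun e => S.graph.connectedComponentMk (Γ.src e) = c),
        (Γ.type e : ℝ))

/-- All subdiagrams have non-negative degree. -/
def NonNegative (d : ℕ) : Prop := ∀ S : Γ.Subdiagram, 0 ≤ S.deg d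

/-! ### The valuation -/

open Classical in
/-- The configuration on `V` with prescribed values at the leaves and at the inner vertices. -/
def glue {X : Type*} (xL : {v // v ∈ Γ.leaves} → X) (xI : {v // v ∉ Γ.leaves} → X) : V → X :=
  fun v => if h : v ∈ Γ.leaves then xL ⟨v, h⟩ else xI ⟨v, h⟩

/-- `∏ K_{𝔱(e), ε}(x_{e₊} - x_{e₋})` over the edges `e ∈ S`. -/
def weight {d : ℕ} (K : 𝔗 → ℝ → Torus d → ℝ) (ε : ℝ) (S : Finset E) (x : V → Torus d) : ℝ :=
  ∏ e ∈ S, K (Γ.type e) ε (x (Γ.tgt e) - x (Γ.src e))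

open Classical in
/-- `Π_ε Γ (x_L)`: integrate the product of all kernels over the inner variables. -/
def val {d : ℕ} (K : 𝔗 → ℝ → Torus d → ℝ) (ε : ℝ)
    (xL : {v // v ∈ Γ.leaves} → Torus d) : ℝ :=
  ∫ xI : {v // v ∉ Γ.leaves} → Torus d,
    Γ.weight K ε Γ.innerEdges (Γ.glue xL xI) * Γ.weight K ε Γ.legs (Γ.glue xL xI)

/-- `Π_ε Γ (φ)`: test the valuation against a function of the leaf variables. -/
def valTest {d : ℕ} (K : 𝔗 → ℝ → Torus d → ℝ) (ε : ℝ)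
    (φ : ({v // v ∈ Γ.leaves} → Torus d) → ℝ) : ℝ :=
  ∫ xL : {v // v ∈ Γ.leaves} → Torus d, Γ.val K ε xL * φ xL

end Diagram

/-! ### Hepp trees -/

/-- Finite rooted (planar) binary trees with leaves labelled by `V`. -/
inductive BinTree (V : Type*) where
  | leaf (v : V) : BinTree V
  | graft (T₁ T₂ : BinTree V) : BinTree V

namespace BinTree

variable {V : Type*}

/-- The multiset of labels of the leaves. -/
def labels : BinTree V → Multiset V
  | leaf v => {v}
  | graft T₁ T₂ => T₁.labels + T₂.labels

open Classical in
/-- For every inner node, the set of leaves below it. -/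
def clusters : BinTree V → Finset (Finset V)
  | leaf _ => ∅
  | graft T₁ T₂ => insert (T₁.labels + T₂.labels).toFinset (T₁.clusters ∪ T₂.clusters)

end BinTree

open Classical in
/-- The Hepp trees over `X`: rooted binary trees whose leaves are in bijection with `X`, the two
children of a node being unordered. Such a tree is recorded by the sets of leaves below its inner
nodes: distinct inner nodes have distinct sets of leaves below them, and two planar trees with
leaves in bijection with `X` have the same family of such sets if and only if they differ by the
order of children only. An element `T` of `heppTrees X` is thus the set of inner nodes of a tree,
and `u ∈ T` is the set of leaves that are descendants of the node. -/
def heppTrees {V : Type*} (X : Finset V) : Finset (Finset (Finset V)) :=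
  X.powerset.powerset.filter (fun F => ∃ T : BinTree V, T.labels = X.val ∧ T.clusters = F)

namespace Diagram

variable {𝔗 : Set ℝ} {V E : Type*} [Fintype V] [Fintype E] (Γ : Diagram 𝔗 V E)

open Classical in
/-- `d (|V⋆(Γ_u)| - 1) + ∑ 𝔱(e)` over the edges `e` of the full subdiagram `Γ_u` spanned by the
set `u` of inner vertices. -/
def degBar (d : ℕ) (u : Finset V) : ℝ :=
  (d : ℝ) * ((u.card : ℝ) - 1) +
    ∑ e ∈ Finset.univ.filter (fun e => Γ.src e ∈ u ∧ Γ.tgt e ∈ u), (Γ.type e : ℝ)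

open Classical in
/-- The number of inner nodes `u` of the Hepp tree `T` for which `degBar u = 0`. -/
def null (d : ℕ) (T : Finset (Finset V)) : ℕ :=
  (T.filter (fun u => Γ.degBar d u = 0)).card

end Diagram

end Feynman

end

noncomputable section

namespace Feynman

namespace BinTree

variable {V : Type*}

/-- Equality of binary trees up to the order of children. -/
inductive SwapEquiv : BinTree V → BinTree V → Prop
  | leaf (v : V) : SwapEquiv (leaf v) (leaf v)
  | congr {A A' B B' : BinTree V} : SwapEquiv A A' → SwapEquiv B B' →
      SwapEquiv (graft A B) (graft A' B')
  | swap {A A' B B' : BinTree V} : SwapEquiv A B' → SwapEquiv B A' →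
      SwapEquiv (graft A B) (graft A' B')

open Classical in
/-- The set of labels of the leaves. -/
def support (T : BinTree V) : Finset V := T.labels.toFinset

/-- The number of inner nodes. -/
def nodes : BinTree V → ℕ
  | leaf _ => 0
  | graft A B => A.nodes + B.nodes + 1

@[simp] theorem support_leaf (v : V) : (leaf v).support = {v} := by
  simp [support, labels]

open Classical in
theorem support_graft (A B : BinTree V) : (graft A B).support = A.support ∪ B.support := by
  simp [support, labels]

@[simp] theorem mem_support {T : BinTree V} {v : V} : v ∈ T.support ↔ v ∈ T.labels := by
  simp [support]

theorem mem_support_graft {A B : BinTree V} {v : V} :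
    v ∈ (graft A B).support ↔ v ∈ A.support ∨ v ∈ B.support := by
  simp [labels]

theorem card_labels (T : BinTree V) : T.labels.card = T.nodes + 1 := by
  induction T with
  | leaf v => simp [labels, nodes]
  | graft A B hA hB => simp [labels, nodes, hA, hB]; omega

theorem support_nonempty (T : BinTree V) : T.support.Nonempty := by
  have h : T.labels ≠ 0 := by
    intro h
    have := T.card_labels
    simp [h] at this
  obtain ⟨v, hv⟩ := Multiset.exists_mem_of_ne_zero h
  exact ⟨v, by simpa using hv⟩

theorem card_support {T : BinTree V} (h : T.labels.Nodup) : T.support.card = T.nodes + 1 := by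
  classical
  rw [support, Multiset.toFinset_card_of_nodup h, card_labels]

theorem mem_sum_labels {𝓕 : Multiset (BinTree V)} {v : V} :
    v ∈ (𝓕.map labels).sum ↔ ∃ T ∈ 𝓕, v ∈ T.support := by
  induction 𝓕 using Multiset.induction_on with
  | empty => simp
  | cons T 𝓕 ih => simp [ih]

theorem nodup_graft {A B : BinTree V} (h : (graft A B).labels.Nodup) :
    A.labels.Nodup ∧ B.labels.Nodup ∧ Disjoint A.support B.support := by
  simp only [labels, Multiset.nodup_add] at h
  refine ⟨h.1, h.2.1, ?_⟩
  rw [Finset.disjoint_left]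
  intro v hA hB
  exact (Multiset.disjoint_left.1 h.2.2) (by simpa using hA) (by simpa using hB)

open Classical in
theorem clusters_graft (A B : BinTree V) :
    (graft A B).clusters = insert (graft A B).support (A.clusters ∪ B.clusters) := rfl

theorem clusters_prop {T : BinTree V} {u : Finset V} (hu : u ∈ T.clusters) :
    u ⊆ T.support ∧ u.Nonempty := by
  classical
  induction T with
  | leaf v => simp [clusters] at hu
  | graft A B hA hB =>
    rw [clusters_graft, Finset.mem_insert, Finset.mem_union] at hu
    rw [support_graft]
    rcases hu with rfl | h | h
    · exact ⟨by rw [support_graft], support_nonempty _⟩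
    · exact ⟨(hA h).1.trans Finset.subset_union_left, (hA h).2⟩
    · exact ⟨(hB h).1.trans Finset.subset_union_right, (hB h).2⟩

theorem not_support_subset_left {A B : BinTree V} (h : Disjoint A.support B.support) :
    ¬ (graft A B).support ⊆ A.support := by
  intro hs
  obtain ⟨v, hv⟩ := B.support_nonempty
  exact Finset.disjoint_left.1 h (hs (mem_support_graft.2 (Or.inr hv))) hv

theorem not_support_subset_right {A B : BinTree V} (h : Disjoint A.support B.support) :
    ¬ (graft A B).support ⊆ B.support := by
  intro hs
  obtain ⟨v, hv⟩ := A.support_nonempty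
  exact Finset.disjoint_left.1 h hv (hs (mem_support_graft.2 (Or.inl hv)))

theorem not_mem_clusters_of_disjoint {A B : BinTree V} (h : Disjoint A.support B.support)
    {u : Finset V} (hu : u ∈ A.clusters) : ¬ u ⊆ B.support := by
  intro hs
  obtain ⟨v, hv⟩ := (clusters_prop hu).2
  exact Finset.disjoint_left.1 h ((clusters_prop hu).1 hv) (hs hv)

theorem mem_clusters_left_iff {A B : BinTree V} (h : Disjoint A.support B.support)
    (u : Finset V) : u ∈ A.clusters ↔ u ∈ (graft A B).clusters ∧ u ⊆ A.support := by
  classical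
  rw [clusters_graft, Finset.mem_insert, Finset.mem_union]
  refine ⟨fun hu => ⟨Or.inr (Or.inl hu), (clusters_prop hu).1⟩, ?_⟩
  rintro ⟨rfl | hu | hu, hs⟩
  · exact absurd hs (not_support_subset_left h)
  · exact hu
  · exact absurd hs (not_mem_clusters_of_disjoint h.symm hu)

theorem mem_clusters_right_iff {A B : BinTree V} (h : Disjoint A.support B.support)
    (u : Finset V) : u ∈ B.clusters ↔ u ∈ (graft A B).clusters ∧ u ⊆ B.support := by
  classical
  rw [clusters_graft, Finset.mem_insert, Finset.mem_union]
  refine ⟨fun hu => ⟨Or.inr (Or.inr hu), (clusters_prop hu).1⟩, ?_⟩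
  rintro ⟨rfl | hu | hu, hs⟩
  · exact absurd hs (not_support_subset_right h)
  · exact absurd hs (not_mem_clusters_of_disjoint h hu)
  · exact hu

theorem support_mem_clusters_or (T : BinTree V) :
    T.support ∈ T.clusters ∨ ∃ v, T.support = {v} := by
  classical
  cases T with
  | leaf v => exact Or.inr ⟨v, by simp⟩
  | graft A B => left; rw [clusters_graft]; exact Finset.mem_insert_self _ _

/-- A subtree lying strictly inside another tree lies inside one of its two branches. -/
theorem support_subset_branch {S A B : BinTree V} (hS : S.clusters ⊆ (graft A B).clusters)
    (hsub : S.support ⊆ (graft A B).support) (hne : S.support ≠ (graft A B).support) :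
    S.support ⊆ A.support ∨ S.support ⊆ B.support := by
  classical
  rcases S.support_mem_clusters_or with h | ⟨v, hv⟩
  · have := hS h
    rw [clusters_graft, Finset.mem_insert, Finset.mem_union] at this
    rcases this with h | h | h
    · exact absurd h hne
    · exact Or.inl (clusters_prop h).1
    · exact Or.inr (clusters_prop h).1
  · rw [hv] at hsub ⊢
    simpa only [Finset.singleton_subset_iff, mem_support_graft] using hsub

theorem support_eq_of_branches {A B A' B' : BinTree V}
    (hd' : Disjoint A'.support B'.support)
    (hs : (graft A B).support = (graft A' B').support)
    (hA : A.support ⊆ A'.support)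
    (hB : B.support ⊆ A'.support ∨ B.support ⊆ B'.support) :
    A.support = A'.support ∧ B.support = B'.support := by
  have hm : ∀ v, (v ∈ A.support ∨ v ∈ B.support) ↔ (v ∈ A'.support ∨ v ∈ B'.support) := fun v => by
    rw [← mem_support_graft, hs, mem_support_graft]
  have hB' : B.support ⊆ B'.support := by
    refine hB.resolve_left fun h => not_support_subset_left hd' ?_
    intro v hv
    rw [mem_support_graft, ← hm] at hv
    exact hv.elim (fun h' => hA h') (fun h' => h h')
  constructor
  · refine hA.antisymm fun v hv => ?_
    exact ((hm v).2 (Or.inl hv)).resolve_right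
      fun h => Finset.disjoint_left.1 hd' hv (hB' h)
  · refine hB'.antisymm fun v hv => ?_
    exact ((hm v).2 (Or.inr hv)).resolve_left
      fun h => Finset.disjoint_left.1 hd' (hA h) hv

/-- A Hepp tree is determined, up to the order of children, by its family of clusters. -/
theorem swapEquiv_of_clusters_eq {T T' : BinTree V} (h : T.labels.Nodup) (h' : T'.labels.Nodup)
    (hs : T.support = T'.support) (hc : T.clusters = T'.clusters) : SwapEquiv T T' := by
  classical
  induction T generalizing T' with
  | leaf v =>
    have h1 := card_support h
    rw [hs, card_support h'] at h1
    cases T' with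
    | leaf w =>
      simp only [support_leaf, Finset.singleton_inj] at hs
      rw [hs]
      exact .leaf w
    | graft A B => simp [nodes] at h1
  | graft A B ihA ihB =>
    have h1 := card_support h
    rw [hs, card_support h'] at h1
    cases T' with
    | leaf w => simp [nodes] at h1
    | graft A' B' =>
      obtain ⟨hA, hB, hd⟩ := nodup_graft h
      obtain ⟨hA', hB', hd'⟩ := nodup_graft h'
      have hcA : A.clusters ⊆ (graft A' B').clusters := by
        intro u hu; rw [← hc]; exact ((mem_clusters_left_iff hd u).1 hu).1
      have hcB : B.clusters ⊆ (graft A' B').clusters := by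
        intro u hu; rw [← hc]; exact ((mem_clusters_right_iff hd u).1 hu).1
      have hsA : A.support ⊆ (graft A' B').support := by
        rw [← hs]; intro v hv; exact mem_support_graft.2 (Or.inl hv)
      have hsB : B.support ⊆ (graft A' B').support := by
        rw [← hs]; intro v hv; exact mem_support_graft.2 (Or.inr hv)
      have hbA := support_subset_branch hcA hsA
        (by rw [← hs]; intro h; exact not_support_subset_left hd h.ge)
      have hbB := support_subset_branch hcB hsB
        (by rw [← hs]; intro h; exact not_support_subset_right hd h.ge)
      rcases hbA with hbA | hbA
      · obtain ⟨e1, e2⟩ := support_eq_of_branches hd' hs hbA hbB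
        refine .congr (ihA hA hA' e1 ?_) (ihB hB hB' e2 ?_)
        · ext u; rw [mem_clusters_left_iff hd, mem_clusters_left_iff hd', hc, e1]
        · ext u; rw [mem_clusters_right_iff hd, mem_clusters_right_iff hd', hc, e2]
      · have hs' : (graft A B).support = (graft B' A').support := by
          rw [hs, support_graft, support_graft, Finset.union_comm]
        obtain ⟨e1, e2⟩ := support_eq_of_branches hd'.symm hs' hbA hbB.symm
        refine .swap (ihA hA hB' e1 ?_) (ihB hB hA' e2 ?_)
        · ext u; rw [mem_clusters_left_iff hd, mem_clusters_right_iff hd', hc, e1]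
        · ext u; rw [mem_clusters_right_iff hd, mem_clusters_left_iff hd', hc, e2]

theorem SwapEquiv.support_eq {T T' : BinTree V} (h : SwapEquiv T T') :
    T.support = T'.support := by
  classical
  induction h with
  | leaf v => rfl
  | congr _ _ h1 h2 => rw [support_graft, support_graft, h1, h2]
  | swap _ _ h1 h2 => rw [support_graft, support_graft, h1, h2, Finset.union_comm]

end BinTree

namespace Diagram

variable {𝔗 : Set ℝ} {V E : Type*} [Fintype E] (Γ : Diagram 𝔗 V E)

open Classical in
/-- The edges with both endpoints in `U`. -/
def edgesIn (U : Finset V) : Finset E :=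
  Finset.univ.filter (fun e => Γ.src e ∈ U ∧ Γ.tgt e ∈ U)

open Classical in
/-- The edges joining `U` and `W`. -/
def cross (U W : Finset V) : Finset E :=
  Finset.univ.filter (fun e => (Γ.src e ∈ U ∧ Γ.tgt e ∈ W) ∨ (Γ.src e ∈ W ∧ Γ.tgt e ∈ U))

theorem mem_edgesIn {U : Finset V} {e : E} :
    e ∈ Γ.edgesIn U ↔ Γ.src e ∈ U ∧ Γ.tgt e ∈ U := by simp [edgesIn]

theorem mem_cross {U W : Finset V} {e : E} :
    e ∈ Γ.cross U W ↔ (Γ.src e ∈ U ∧ Γ.tgt e ∈ W) ∨ (Γ.src e ∈ W ∧ Γ.tgt e ∈ U) := by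
  simp [cross]

theorem cross_comm (U W : Finset V) : Γ.cross U W = Γ.cross W U := by
  ext e; rw [mem_cross, mem_cross, or_comm]

@[to_additive]
theorem prod_edgesIn_union {M : Type*} [CommMonoid M] [DecidableEq V] {U W : Finset V}
    (h : Disjoint U W) (f : E → M) :
    ∏ e ∈ Γ.edgesIn (U ∪ W), f e =
      (∏ e ∈ Γ.cross U W, f e) * ((∏ e ∈ Γ.edgesIn U, f e) * ∏ e ∈ Γ.edgesIn W, f e) := by
  classical
  have hd : ∀ v, v ∈ U → v ∉ W := fun v hU => Finset.disjoint_left.1 h hU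
  have e1 : Γ.edgesIn (U ∪ W) = Γ.cross U W ∪ (Γ.edgesIn U ∪ Γ.edgesIn W) := by
    ext e
    simp only [Finset.mem_union, mem_edgesIn, mem_cross]
    tauto
  rw [e1, Finset.prod_union, Finset.prod_union]
  · rw [Finset.disjoint_left]
    intro e h1 h2
    rw [mem_edgesIn] at h1 h2
    exact hd _ h1.1 h2.1
  · rw [Finset.disjoint_left]
    intro e h1 h2
    simp only [Finset.mem_union, mem_edgesIn, mem_cross] at h1 h2
    have := hd (Γ.src e); have := hd (Γ.tgt e)
    tauto

theorem null_clusters_leaf (d : ℕ) (v : V) : Γ.null d (BinTree.leaf v).clusters = 0 := by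
  simp [null, BinTree.clusters]

open Classical in
theorem null_clusters_graft (d : ℕ) {A B : BinTree V} (h : Disjoint A.support B.support) :
    Γ.null d (BinTree.graft A B).clusters =
      Γ.null d A.clusters + Γ.null d B.clusters +
        if Γ.degBar d (BinTree.graft A B).support = 0 then 1 else 0 := by
  have h1 : (BinTree.graft A B).support ∉ A.clusters ∪ B.clusters := by
    rw [Finset.mem_union]
    rintro (hu | hu)
    · exact BinTree.not_support_subset_left h (BinTree.clusters_prop hu).1
    · exact BinTree.not_support_subset_right h (BinTree.clusters_prop hu).1
  have h2 : Disjoint A.clusters B.clusters := by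
    rw [Finset.disjoint_left]
    intro u hu hu'
    exact BinTree.not_mem_clusters_of_disjoint h hu (BinTree.clusters_prop hu').1
  simp only [null, BinTree.clusters_graft, Finset.card_filter]
  rw [Finset.sum_insert h1, Finset.sum_union h2, add_comm]

/-- `Γ.Linked s N T n`: the inner nodes of `T` can be labelled by scales between `n` and `N`,
increasing away from the root, in such a way that the label `m` of a node is the largest scale `s e`
of an edge `e` joining its two branches, or is `0`. -/
def Linked (s : E → ℕ) (N : ℕ) : BinTree V → ℕ → Prop
  | .leaf _, n => n ≤ N
  | .graft A B, n => ∃ m, n ≤ m ∧ m ≤ N ∧ Linked s N A m ∧ Linked s N B m ∧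
      (∀ e ∈ Γ.cross A.support B.support, s e ≤ m) ∧
      (m = 0 ∨ ∃ e ∈ Γ.cross A.support B.support, s e = m)

variable {Γ} in
theorem Linked.anti {s : E → ℕ} {N : ℕ} {T : BinTree V} {n n' : ℕ} (h : Γ.Linked s N T n)
    (hn : n' ≤ n) : Γ.Linked s N T n' := by
  cases T with
  | leaf v => exact hn.trans h
  | graft A B =>
    obtain ⟨m, h1, h2⟩ := h
    exact ⟨m, hn.trans h1, h2⟩

theorem exists_linked_of_forest {s : E → ℕ} {N : ℕ} {X : Finset V} (c : ℕ) :
    ∀ (𝓕 : Multiset (BinTree V)) (n : ℕ), 𝓕.card = c + 1 → (𝓕.map BinTree.labels).sum = X.val →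
      n ≤ N → (∀ T ∈ 𝓕, Γ.Linked s N T n) →
      (∀ e ∈ Γ.edgesIn X, (¬ ∃ T ∈ 𝓕, Γ.src e ∈ T.support ∧ Γ.tgt e ∈ T.support) → s e ≤ n) →
      ∃ T : BinTree V, T.labels = X.val ∧ Γ.Linked s N T 0 := by
  classical
  induction c with
  | zero =>
    intro 𝓕 n hc hX _ hl _
    obtain ⟨T, rfl⟩ := Multiset.card_eq_one.1 hc
    exact ⟨T, by simpa using hX, (hl T (by simp)).anti (Nat.zero_le _)⟩
  | succ c ih =>
    intro 𝓕 n hc hX hn hl hs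
    set ext := (Γ.edgesIn X).filter
      (fun e => ¬ ∃ T ∈ 𝓕, Γ.src e ∈ T.support ∧ Γ.tgt e ∈ T.support) with hext
    have hmem : ∀ e ∈ Γ.edgesIn X,
        (¬ ∃ T ∈ 𝓕, Γ.src e ∈ T.support ∧ Γ.tgt e ∈ T.support) → e ∈ ext :=
      fun e h1 h2 => Finset.mem_filter.2 ⟨h1, h2⟩
    set m := ext.sup s with hm
    have hmn : m ≤ n := Finset.sup_le fun e he => by
      rw [hext, Finset.mem_filter] at he
      exact hs e he.1 he.2
    have hcov : ∀ v ∈ X, ∃ T ∈ 𝓕, v ∈ T.support := fun v hv => by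
      rwa [← Finset.mem_val, ← hX, BinTree.mem_sum_labels] at hv
    -- the two trees to be grafted
    obtain ⟨A, B, R, rfl, hAB⟩ : ∃ A B R, 𝓕 = A ::ₘ B ::ₘ R ∧
        (m = 0 ∨ ∃ e ∈ Γ.cross A.support B.support, s e = m) := by
      by_cases hne : ext.Nonempty
      · obtain ⟨e, he, hse⟩ := Finset.exists_mem_eq_sup ext hne s
        rw [hext, Finset.mem_filter, mem_edgesIn] at he
        obtain ⟨A, hA, hvA⟩ := hcov _ he.1.1
        obtain ⟨B, hB, hvB⟩ := hcov _ he.1.2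
        have hBA : B ≠ A := by
          rintro rfl
          exact he.2 ⟨B, hA, hvA, hvB⟩
        obtain ⟨R', rfl⟩ := Multiset.exists_cons_of_mem hA
        obtain ⟨R, rfl⟩ := Multiset.exists_cons_of_mem
          ((Multiset.mem_cons.1 hB).resolve_left hBA)
        exact ⟨A, B, R, rfl, Or.inr ⟨e, (mem_cross _).2 (Or.inl ⟨hvA, hvB⟩), hse.symm⟩⟩
      · obtain ⟨A, hA⟩ := Multiset.card_pos_iff_exists_mem.1 (by omega : 0 < 𝓕.card)
        obtain ⟨R', rfl⟩ := Multiset.exists_cons_of_mem hA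
        rw [Multiset.card_cons] at hc
        obtain ⟨B, hB⟩ := Multiset.card_pos_iff_exists_mem.1 (by omega : 0 < R'.card)
        obtain ⟨R, rfl⟩ := Multiset.exists_cons_of_mem hB
        refine ⟨A, B, R, rfl, Or.inl ?_⟩
        rw [hm, Finset.not_nonempty_iff_eq_empty.1 hne, Finset.sup_empty]
        rfl
    have hnd := X.nodup
    rw [← hX] at hnd
    simp only [Multiset.map_cons, Multiset.sum_cons] at hX hnd
    have hsub : ∀ T ∈ A ::ₘ B ::ₘ R, T.support ⊆ X := fun T hT v hv => by
      rw [← Finset.mem_val, ← hX]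
      have : v ∈ (Multiset.map BinTree.labels (A ::ₘ B ::ₘ R)).sum :=
        BinTree.mem_sum_labels.2 ⟨T, hT, hv⟩
      simpa using this
    -- no other tree meets both branches
    have hdisj : ∀ v w, v ∈ A.support → w ∈ B.support →
        ¬ ∃ T ∈ A ::ₘ B ::ₘ R, v ∈ T.support ∧ w ∈ T.support := by
      rintro v w hv hw ⟨T, hT, hvT, hwT⟩
      rw [Multiset.nodup_add, Multiset.nodup_add] at hnd
      obtain ⟨-, ⟨-, -, hBR⟩, hAB⟩ := hnd
      rw [Multiset.mem_cons, Multiset.mem_cons] at hT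
      rcases hT with rfl | rfl | hT
      · exact Multiset.disjoint_left.1 hAB (BinTree.mem_support.1 hwT)
          (Multiset.mem_add.2 (Or.inl (BinTree.mem_support.1 hw)))
      · exact Multiset.disjoint_left.1 hAB (BinTree.mem_support.1 hv)
          (Multiset.mem_add.2 (Or.inl (BinTree.mem_support.1 hvT)))
      · exact Multiset.disjoint_left.1 hBR (BinTree.mem_support.1 hw)
          (BinTree.mem_sum_labels.2 ⟨T, hT, hwT⟩)
    refine ih (.graft A B ::ₘ R) m (by simpa using hc) ?_ (hmn.trans hn) ?_ ?_
    · rw [← hX, Multiset.map_cons, Multiset.sum_cons, BinTree.labels, add_assoc]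
    · intro T hT
      rcases Multiset.mem_cons.1 hT with rfl | hT
      · refine ⟨m, le_rfl, hmn.trans hn, (hl A (by simp)).anti hmn, (hl B (by simp)).anti hmn,
          fun e he => ?_, hAB⟩
        refine Finset.le_sup (f := s) (hmem e ?_ ?_)
        · have hA := hsub A (by simp)
          have hB := hsub B (by simp)
          rw [mem_cross] at he
          rw [mem_edgesIn]
          exact he.elim (fun h => ⟨hA h.1, hB h.2⟩) (fun h => ⟨hB h.1, hA h.2⟩)
        · rcases (mem_cross _).1 he with h | h
          · exact hdisj _ _ h.1 h.2
          · rintro ⟨T, hT, h1, h2⟩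
            exact hdisj _ _ h.2 h.1 ⟨T, hT, h2, h1⟩
      · exact (hl T (by simp [hT])).anti hmn
    · intro e he hT
      refine Finset.le_sup (f := s) (hmem e he ?_)
      rintro ⟨T, hT', h1, h2⟩
      rw [Multiset.mem_cons, Multiset.mem_cons] at hT'
      rcases hT' with rfl | rfl | h
      · exact hT ⟨_, Multiset.mem_cons_self _ _, BinTree.mem_support_graft.2 (Or.inl h1),
          BinTree.mem_support_graft.2 (Or.inl h2)⟩
      · exact hT ⟨_, Multiset.mem_cons_self _ _, BinTree.mem_support_graft.2 (Or.inr h1),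
          BinTree.mem_support_graft.2 (Or.inr h2)⟩
      · exact hT ⟨T, Multiset.mem_cons_of_mem h, h1, h2⟩

/-- Single-linkage clustering: every assignment of scales to the edges is adapted to some Hepp
tree. -/
theorem exists_linked {s : E → ℕ} {N : ℕ} (hs : ∀ e, s e ≤ N) {X : Finset V} (hX : X.Nonempty) :
    ∃ T : BinTree V, T.labels = X.val ∧ Γ.Linked s N T 0 := by
  obtain ⟨c, hc⟩ : ∃ c, X.card = c + 1 := ⟨X.card - 1, by have := hX.card_pos; omega⟩
  refine Γ.exists_linked_of_forest c (X.val.map BinTree.leaf) N (by simpa using hc) ?_ le_rfl ?_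
    (fun e _ _ => hs e)
  · rw [Multiset.map_map]
    exact Multiset.sum_map_singleton _
  · intro T hT
    obtain ⟨v, -, rfl⟩ := Multiset.mem_map.1 hT
    exact le_rfl

end Diagram

namespace Diagram

variable {𝔗 : Set ℝ} {V E : Type*} (Γ : Diagram 𝔗 V E)

/-- The strength `max (-𝔱(e)) 0` of the singularity at an edge with integer type. -/
def negPart (e : E) : ℕ := ⌊-(Γ.type e : ℝ)⌋₊

theorem negPart_eq_zero {e : E} (ht : 0 ≤ (Γ.type e : ℝ)) : Γ.negPart e = 0 :=
  Nat.floor_eq_zero.2 (by linarith)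

variable {Γ} in
theorem Subdiagram.deg_le [Fintype V] (d : ℕ) (S : Γ.Subdiagram) (hS : S.verts.Nonempty) :
    S.deg d ≤ d * ((S.verts.card : ℝ) - 1) + ∑ e ∈ S.edges, (Γ.type e : ℝ) := by
  classical
  rw [Subdiagram.deg, Finset.sum_add_distrib, ← Finset.mul_sum, Finset.sum_sub_distrib,
    Finset.sum_fiberwise_of_maps_to (g := fun e => S.graph.connectedComponentMk (Γ.src e))
      (fun e he => Finset.mem_image_of_mem _ (S.src_mem e he)) (fun e => (Γ.type e : ℝ)),
    ← Nat.cast_sum, ← Finset.card_eq_sum_card_image]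
  have h1 : (1 : ℝ) ≤ ((S.verts.image S.graph.connectedComponentMk).card : ℝ) := by
    exact_mod_cast (hS.image _).card_pos
  gcongr
  simpa using h1

variable [Fintype E]

theorem mem_innerEdges [Fintype V] {e : E} :
    e ∈ Γ.innerEdges ↔ Γ.src e ∈ Γ.inner ∧ Γ.tgt e ∈ Γ.inner := by
  simp [innerEdges]

theorem edgesIn_inner [Fintype V] : Γ.edgesIn Γ.inner = Γ.innerEdges := by
  ext e; rw [mem_edgesIn, mem_innerEdges]

/-- The types of the inner edges are integers. -/
def IntegerTypes [Fintype V] : Prop := ∀ e ∈ Γ.innerEdges, ∃ n : ℤ, (Γ.type e : ℝ) = n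

variable {Γ} in
theorem IntegerTypes.negPart_eq [Fintype V] (h : Γ.IntegerTypes) {e : E} (he : e ∈ Γ.innerEdges)
    (ht : (Γ.type e : ℝ) ≤ 0) : (Γ.negPart e : ℝ) = -(Γ.type e : ℝ) := by
  obtain ⟨n, hn⟩ := h e he
  have hn0 : n ≤ 0 := by rw [hn] at ht; exact_mod_cast ht
  obtain ⟨k, rfl⟩ := Int.exists_eq_neg_ofNat hn0
  simp [negPart, hn]

variable {Γ} in
theorem NonNegative.sum_negPart_le [Fintype V] {d : ℕ} (h : Γ.NonNegative d) (hZ : Γ.IntegerTypes)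
    {U : Finset V} (hU : U.Nonempty) (hsub : U ⊆ Γ.inner) :
    ((∑ e ∈ Γ.edgesIn U, Γ.negPart e : ℕ) : ℝ) ≤ d * ((U.card : ℝ) - 1) := by
  classical
  let S : Γ.Subdiagram :=
    { verts := U
      edges := (Γ.edgesIn U).filter fun e => (Γ.type e : ℝ) < 0
      verts_subset := hsub
      src_mem := fun e he => (Γ.mem_edgesIn.1 (Finset.mem_filter.1 he).1).1
      tgt_mem := fun e he => (Γ.mem_edgesIn.1 (Finset.mem_filter.1 he).1).2 }
  have h1 := (h S).trans (S.deg_le d hU)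
  have h2 : ((∑ e ∈ Γ.edgesIn U, Γ.negPart e : ℕ) : ℝ) = -∑ e ∈ S.edges, (Γ.type e : ℝ) := by
    rw [Nat.cast_sum, ← Finset.sum_neg_distrib, Finset.sum_filter]
    refine Finset.sum_congr rfl fun e he => ?_
    rw [mem_edgesIn] at he
    split_ifs with ht
    · exact hZ.negPart_eq (Γ.mem_innerEdges.2 ⟨hsub he.1, hsub he.2⟩) ht.le
    · rw [negPart_eq_zero _ (not_lt.1 ht), Nat.cast_zero]
  have h3 : S.verts = U := rfl
  rw [h3] at h1
  linarith

open Classical in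
/-- Indicates that `U` and `W` are joined by an edge of positive type, unless `p ≠ 0`. -/
def newPos (p : ℕ) (U W : Finset V) : ℕ :=
  if p = 0 ∧ ∃ e ∈ Γ.cross U W, 0 < (Γ.type e : ℝ) then 1 else 0

open Classical in
/-- The number of minimal subtrees of `T` whose leaves span an edge of positive type. -/
def posCount : BinTree V → ℕ
  | .leaf v => if ∃ e ∈ Γ.edgesIn {v}, 0 < (Γ.type e : ℝ) then 1 else 0
  | .graft A B => posCount A + posCount B +
      Γ.newPos (posCount A + posCount B) A.support B.support

theorem newPos_comm (p : ℕ) (U W : Finset V) : Γ.newPos p U W = Γ.newPos p W U := by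
  rw [newPos, newPos, cross_comm]

theorem newPos_eq_zero_or (p : ℕ) (U W : Finset V) :
    Γ.newPos p U W = 0 ∨ (Γ.newPos p U W = 1 ∧ p = 0 ∧
      ∃ e ∈ Γ.cross U W, 0 < (Γ.type e : ℝ)) := by
  by_cases h : p = 0 ∧ ∃ e ∈ Γ.cross U W, 0 < (Γ.type e : ℝ)
  · exact Or.inr ⟨if_pos h, h⟩
  · exact Or.inl (if_neg h)

theorem type_nonpos_of_posCount {T : BinTree V} (h : Γ.posCount T = 0) :
    ∀ e ∈ Γ.edgesIn T.support, (Γ.type e : ℝ) ≤ 0 := by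
  classical
  induction T with
  | leaf v =>
    intro e he
    by_contra! ht
    rw [BinTree.support_leaf] at he
    rw [posCount, if_pos ⟨e, he, ht⟩] at h
    exact one_ne_zero h
  | graft A B hA hB =>
    rw [posCount, Nat.add_eq_zero_iff, Nat.add_eq_zero_iff] at h
    intro e he
    have hcross : e ∈ Γ.cross A.support B.support → (Γ.type e : ℝ) ≤ 0 := by
      intro hc
      by_contra! ht
      have h2 := h.2
      rw [newPos, if_pos ⟨by omega, e, hc, ht⟩] at h2
      exact one_ne_zero h2
    rw [mem_edgesIn, BinTree.mem_support_graft, BinTree.mem_support_graft] at he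
    rcases he with ⟨h1 | h1, h2 | h2⟩
    · exact hA h.1.1 e (Γ.mem_edgesIn.2 ⟨h1, h2⟩)
    · exact hcross (Γ.mem_cross.2 (Or.inl ⟨h1, h2⟩))
    · exact hcross (Γ.mem_cross.2 (Or.inr ⟨h1, h2⟩))
    · exact hB h.1.2 e (Γ.mem_edgesIn.2 ⟨h1, h2⟩)

/-- The exponential rate of decay of the contribution of the tree `T` in the scale of its root. -/
def excess (d : ℕ) (T : BinTree V) : ℤ :=
  d * T.nodes - (∑ e ∈ Γ.edgesIn T.support, Γ.negPart e : ℕ) + Γ.posCount T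

variable {Γ} in
theorem NonNegative.posCount_le_excess [Fintype V] {d : ℕ} (h : Γ.NonNegative d)
    (hZ : Γ.IntegerTypes) {T : BinTree V} (hT : T.labels.Nodup) (hsub : T.support ⊆ Γ.inner) :
    (Γ.posCount T : ℤ) ≤ Γ.excess d T := by
  have h1 := h.sum_negPart_le hZ T.support_nonempty hsub
  rw [BinTree.card_support hT] at h1
  have h2 : ((∑ e ∈ Γ.edgesIn T.support, Γ.negPart e : ℕ) : ℝ) ≤ ((d * T.nodes : ℕ) : ℝ) := by
    refine h1.trans (le_of_eq ?_)
    push_cast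
    ring
  rw [Nat.cast_le] at h2
  rw [excess]
  have : ((∑ e ∈ Γ.edgesIn T.support, Γ.negPart e : ℕ) : ℤ) ≤ ((d * T.nodes : ℕ) : ℤ) := by
    exact_mod_cast h2
  push_cast at this ⊢
  linarith

variable {Γ} in
theorem NonNegative.degBar_eq_zero [Fintype V] {d : ℕ} (h : Γ.NonNegative d) (hZ : Γ.IntegerTypes)
    {T : BinTree V} (hT : T.labels.Nodup) (hsub : T.support ⊆ Γ.inner)
    (h0 : Γ.excess d T = 0) : Γ.degBar d T.support = 0 := by
  have hp : Γ.posCount T = 0 := by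
    have := h.posCount_le_excess hZ hT hsub
    omega
  have h1 : Γ.degBar d T.support =
      d * ((T.support.card : ℝ) - 1) + ∑ e ∈ Γ.edgesIn T.support, (Γ.type e : ℝ) := rfl
  have h2 : ((∑ e ∈ Γ.edgesIn T.support, Γ.negPart e : ℕ) : ℝ) =
      -∑ e ∈ Γ.edgesIn T.support, (Γ.type e : ℝ) := by
    rw [Nat.cast_sum, ← Finset.sum_neg_distrib]
    refine Finset.sum_congr rfl fun e he => ?_
    have he' := Γ.mem_edgesIn.1 he
    exact hZ.negPart_eq (Γ.mem_innerEdges.2 ⟨hsub he'.1, hsub he'.2⟩)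
      (Γ.type_nonpos_of_posCount hp e he)
  rw [excess, hp] at h0
  have h3 : (d : ℝ) * T.nodes - (∑ e ∈ Γ.edgesIn T.support, Γ.negPart e : ℕ) + (0 : ℕ) = 0 := by
    exact_mod_cast h0
  rw [h1, BinTree.card_support hT]
  push_cast at h2 h3 ⊢
  linarith

open BinTree in
theorem excess_graft (d : ℕ) {A B : BinTree V} (h : Disjoint A.support B.support) :
    Γ.excess d (.graft A B) = Γ.excess d A + Γ.excess d B + d
      - (∑ e ∈ Γ.cross A.support B.support, Γ.negPart e : ℕ)
      + Γ.newPos (Γ.posCount A + Γ.posCount B) A.support B.support := by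
  classical
  simp only [excess, support_graft, Γ.sum_edgesIn_union h, posCount, nodes]
  push_cast
  ring

theorem card_edgesIn_graft {A B : BinTree V} (h : Disjoint A.support B.support) :
    (Γ.edgesIn (BinTree.graft A B).support).card = (Γ.cross A.support B.support).card +
      ((Γ.edgesIn A.support).card + (Γ.edgesIn B.support).card) := by
  classical
  simp only [Finset.card_eq_sum_ones, BinTree.support_graft, Γ.sum_edgesIn_union h]

/-- The weight of a node at scale `m` with branches `A` and `B`. -/
def growth (A B : BinTree V) (m : ℕ) : ℝ :=
  2 ^ (m * ∑ e ∈ Γ.cross A.support B.support, Γ.negPart e) *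
    (4 * (A.support.card + B.support.card) / 2 ^ m) ^
      Γ.newPos (Γ.posCount A + Γ.posCount B) A.support B.support

theorem growth_nonneg (A B : BinTree V) (m : ℕ) : 0 ≤ Γ.growth A B m := by
  unfold growth; positivity

/-- The sum over all scale labellings of `T` with root label at least `n`. -/
def treeSum (d : ℕ) (κ : ℝ) (N : ℕ) : BinTree V → ℕ → ℝ
  | .leaf v, n => (1 / 2) ^ (n * Γ.posCount (.leaf v))
  | .graft A B, n => ∑ m ∈ Finset.Icc n N, Γ.growth A B m *
      ((if m = 0 then 1 else 0) + (Γ.cross A.support B.support).card * (κ / 2 ^ (d * m))) *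
      (treeSum d κ N A m * treeSum d κ N B m)

theorem treeSum_nonneg (d : ℕ) {κ : ℝ} (hκ : 0 ≤ κ) (N : ℕ) (T : BinTree V) (n : ℕ) :
    0 ≤ Γ.treeSum d κ N T n := by
  induction T generalizing n with
  | leaf v => unfold treeSum; positivity
  | graft A B hA hB =>
    unfold treeSum
    refine Finset.sum_nonneg fun m _ => mul_nonneg (mul_nonneg (Γ.growth_nonneg A B m) ?_)
      (mul_nonneg (hA m) (hB m))
    split_ifs <;> positivity

/-- The loss from bounding distances in minimal clusters spanning an edge of positive type. -/
def posConst (T : BinTree V) : ℝ := if Γ.posCount T = 0 then 1 else 8 ^ T.support.card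

theorem one_le_posConst (T : BinTree V) : 1 ≤ Γ.posConst T := by
  unfold posConst
  split_ifs
  · exact le_rfl
  · exact one_le_pow₀ (by norm_num)

theorem posConst_le (T : BinTree V) : Γ.posConst T ≤ 8 ^ T.support.card := by
  unfold posConst
  split_ifs
  · exact one_le_pow₀ (by norm_num)
  · exact le_rfl

theorem posConst_graft {A B : BinTree V} (h : Disjoint A.support B.support) :
    (4 * (A.support.card + B.support.card : ℝ)) ^
      Γ.newPos (Γ.posCount A + Γ.posCount B) A.support B.support *
        (Γ.posConst A * Γ.posConst B) ≤ Γ.posConst (.graft A B) := by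
  classical
  have hcard : (BinTree.graft A B).support.card = A.support.card + B.support.card := by
    rw [BinTree.support_graft, Finset.card_union_of_disjoint h]
  rcases Γ.newPos_eq_zero_or (Γ.posCount A + Γ.posCount B) A.support B.support
    with h0 | ⟨h1, hp, -⟩
  · rw [h0, pow_zero, one_mul]
    by_cases hp : Γ.posCount A + Γ.posCount B = 0
    · have hA : Γ.posCount A = 0 := by omega
      have hB : Γ.posCount B = 0 := by omega
      have : Γ.posCount (.graft A B) = 0 := by rw [posCount, h0, hp]
      simp [posConst, this, hA, hB]
    · rw [posConst.eq_1 Γ (.graft A B), if_neg (by rw [posCount]; omega), hcard, pow_add]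
      exact mul_le_mul (Γ.posConst_le A) (Γ.posConst_le B)
        (zero_le_one.trans (Γ.one_le_posConst B)) (by positivity)
  · have hA : Γ.posCount A = 0 := by omega
    have hB : Γ.posCount B = 0 := by omega
    rw [posConst, posConst, if_pos hA, if_pos hB, posConst, if_neg (by rw [posCount]; omega), h1,
      hcard, pow_one, mul_one, mul_one]
    have hk : 1 ≤ A.support.card + B.support.card := by
      have := A.support_nonempty.card_pos; omega
    rw [← Nat.cast_add]
    generalize A.support.card + B.support.card = k at hk
    have h2 : (k : ℝ) ≤ 2 ^ k := by exact_mod_cast Nat.lt_two_pow_self.le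
    have h4 : (4 : ℝ) ≤ 4 ^ k := le_self_pow₀ (by norm_num) (by omega)
    calc (4 : ℝ) * k ≤ 4 ^ k * 2 ^ k := by gcongr
      _ = 8 ^ k := by rw [← mul_pow]; norm_num

theorem sum_Icc_zpow_le {D : ℤ} (hD : 0 ≤ D) {n N : ℕ} {L : ℝ} (hL : 1 ≤ L)
    (hN : (N : ℝ) + 1 ≤ 3 * L) (p : ℕ) (hp : D = 0 → p = 1) :
    ∑ m ∈ Finset.Icc n N, (2 : ℝ) ^ (-(m : ℤ) * D) ≤ 3 * (2 : ℝ) ^ (-(n : ℤ) * D) * L ^ p := by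
  rcases hD.eq_or_lt with rfl | hD
  · rw [hp rfl]
    simp only [mul_zero, zpow_zero, Finset.sum_const, Nat.card_Icc, nsmul_eq_mul, mul_one, pow_one]
    refine le_trans ?_ hN
    have : N + 1 - n ≤ N + 1 := Nat.sub_le _ _
    exact_mod_cast this
  · have h1 : ∀ m ∈ Finset.Icc n N, (2 : ℝ) ^ (-(m : ℤ) * D) ≤
        (2 : ℝ) ^ (-(n : ℤ) * D) * (1 / 2) ^ (m - n) := by
      intro m hm
      rw [Finset.mem_Icc] at hm
      have e1 : ((1 : ℝ) / 2) ^ (m - n) = 2 ^ (-((m - n : ℕ) : ℤ)) := by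
        rw [zpow_neg, zpow_natCast, one_div, inv_pow]
      rw [e1, ← zpow_add₀ two_ne_zero]
      refine zpow_le_zpow_right₀ one_le_two ?_
      rw [Nat.cast_sub hm.1]
      have : (n : ℤ) ≤ m := by exact_mod_cast hm.1
      nlinarith
    refine (Finset.sum_le_sum h1).trans ?_
    rw [← Finset.mul_sum]
    have h2 : ∑ m ∈ Finset.Icc n N, ((1 : ℝ) / 2) ^ (m - n) ≤ 2 := by
      have : ∑ m ∈ Finset.Icc n N, ((1 : ℝ) / 2) ^ (m - n) =
          ∑ k ∈ Finset.range (N + 1 - n), ((1 : ℝ) / 2) ^ k := by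
        rw [← Finset.Ico_succ_right_eq_Icc, Finset.sum_Ico_eq_sum_range]
        simp
      rw [this]
      exact sum_geometric_two_le _
    have h3 : (1 : ℝ) ≤ L ^ p := one_le_pow₀ hL
    have h4 : (0 : ℝ) < (2 : ℝ) ^ (-(n : ℤ) * D) := by positivity
    nlinarith

theorem treeSum_le [Fintype V] {d : ℕ} (h : Γ.NonNegative d) (hZ : Γ.IntegerTypes) {κ L : ℝ}
    (hκ : 1 ≤ κ) (hL : 1 ≤ L) {N : ℕ} (hN : (N : ℝ) + 1 ≤ 3 * L) {T : BinTree V} (hT : T.labels.Nodup)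
    (hsub : T.support ⊆ Γ.inner) (n : ℕ) :
    Γ.treeSum d κ N T n ≤ Γ.posConst T * (3 * κ) ^ T.nodes *
      2 ^ (Γ.edgesIn T.support).card * (2 : ℝ) ^ (-(n : ℤ) * Γ.excess d T) *
      L ^ Γ.null d T.clusters := by
  classical
  induction T generalizing n with
  | leaf v =>
    have h0 : (Γ.posCount (.leaf v) : ℤ) = Γ.excess d (.leaf v) := by
      refine le_antisymm (h.posCount_le_excess hZ hT hsub) ?_
      rw [excess, BinTree.nodes]
      push_cast
      have : (0 : ℤ) ≤ ∑ e ∈ Γ.edgesIn (BinTree.leaf v).support, (Γ.negPart e : ℤ) :=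
        Finset.sum_nonneg fun _ _ => by positivity
      linarith
    rw [null_clusters_leaf, pow_zero, mul_one, BinTree.nodes, pow_zero, mul_one, treeSum, ← h0]
    have h1 : ((1 : ℝ) / 2) ^ (n * Γ.posCount (.leaf v)) =
        (2 : ℝ) ^ (-(n : ℤ) * (Γ.posCount (.leaf v) : ℤ)) := by
      rw [neg_mul, zpow_neg, ← Nat.cast_mul, zpow_natCast, one_div, inv_pow]
    rw [h1]
    refine le_mul_of_one_le_left (by positivity) ?_
    exact one_le_mul_of_one_le_of_one_le (Γ.one_le_posConst _) (one_le_pow₀ one_le_two)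
  | graft A B ihA ihB =>
    obtain ⟨hA, hB, hd⟩ := BinTree.nodup_graft hT
    have hsA : A.support ⊆ Γ.inner := fun v hv => hsub (BinTree.mem_support_graft.2 (Or.inl hv))
    have hsB : B.support ⊆ Γ.inner := fun v hv => hsub (BinTree.mem_support_graft.2 (Or.inr hv))
    set c := (Γ.cross A.support B.support).card with hc
    set ν := Γ.newPos (Γ.posCount A + Γ.posCount B) A.support B.support with hν
    set a := ∑ e ∈ Γ.cross A.support B.support, Γ.negPart e with ha
    set k : ℝ := A.support.card + B.support.card with hk
    set D := Γ.excess d (.graft A B) with hD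
    have hDe : D = Γ.excess d A + Γ.excess d B + d - a + ν := Γ.excess_graft d hd
    have hterm : ∀ m ∈ Finset.Icc n N, Γ.growth A B m *
        ((if m = 0 then 1 else 0) + c * (κ / 2 ^ (d * m))) *
          (Γ.treeSum d κ N A m * Γ.treeSum d κ N B m) ≤
        Γ.posConst (.graft A B) * (κ * (3 * κ) ^ (A.nodes + B.nodes)) *
          2 ^ (Γ.edgesIn (BinTree.graft A B).support).card *
          L ^ (Γ.null d A.clusters + Γ.null d B.clusters) * (2 : ℝ) ^ (-(m : ℤ) * D) := by
      intro m _
      have h1 : ((if m = 0 then 1 else 0) + c * (κ / 2 ^ (d * m)) : ℝ) ≤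
          2 ^ c * κ / 2 ^ (d * m) := by
        have h2 : (c : ℝ) + 1 ≤ 2 ^ c := by exact_mod_cast Nat.lt_two_pow_self
        have h3 : (if m = 0 then 1 else 0 : ℝ) ≤ κ / 2 ^ (d * m) := by
          split_ifs with hm
          · simpa [hm] using hκ
          · positivity
        have h4 : 0 ≤ κ / 2 ^ (d * m) := by positivity
        rw [mul_div_assoc]
        nlinarith
      have hpA := zero_le_one.trans (Γ.one_le_posConst A)
      have hpB := zero_le_one.trans (Γ.one_le_posConst B)
      have hpAB := zero_le_one.trans (Γ.one_le_posConst (.graft A B))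
      have hz : (2 : ℝ) ^ (-(m : ℤ) * D) = 2 ^ (m * a) * (1 / 2 ^ m) ^ ν * (1 / 2 ^ (d * m)) *
          ((2 : ℝ) ^ (-(m : ℤ) * Γ.excess d A) * (2 : ℝ) ^ (-(m : ℤ) * Γ.excess d B)) := by
        have e1 : ((1 : ℝ) / 2 ^ m) ^ ν = 2 ^ (-((m * ν : ℕ) : ℤ)) := by
          rw [zpow_neg, zpow_natCast, one_div, inv_pow, ← pow_mul]
        have e2 : (1 : ℝ) / 2 ^ (d * m) = 2 ^ (-((d * m : ℕ) : ℤ)) := by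
          rw [zpow_neg, zpow_natCast, one_div]
        have e3 : (2 : ℝ) ^ (m * a) = 2 ^ ((m * a : ℕ) : ℤ) := (zpow_natCast _ _).symm
        rw [e1, e2, e3]
        simp only [← zpow_add₀ (two_ne_zero (α := ℝ))]
        congr 1
        rw [hDe]
        push_cast
        ring
      calc _ ≤ Γ.growth A B m * (2 ^ c * κ / 2 ^ (d * m)) *
            ((Γ.posConst A * (3 * κ) ^ A.nodes * 2 ^ (Γ.edgesIn A.support).card *
                (2 : ℝ) ^ (-(m : ℤ) * Γ.excess d A) * L ^ Γ.null d A.clusters) *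
             (Γ.posConst B * (3 * κ) ^ B.nodes * 2 ^ (Γ.edgesIn B.support).card *
                (2 : ℝ) ^ (-(m : ℤ) * Γ.excess d B) * L ^ Γ.null d B.clusters)) := by
            refine mul_le_mul (mul_le_mul_of_nonneg_left h1 (Γ.growth_nonneg A B m))
              (mul_le_mul (ihA hA hsA m) (ihB hB hsB m)
                (Γ.treeSum_nonneg d (by linarith) N B m) (by positivity))
              (mul_nonneg (Γ.treeSum_nonneg d (by linarith) N A m)
                (Γ.treeSum_nonneg d (by linarith) N B m))
              (mul_nonneg (Γ.growth_nonneg A B m) (by positivity))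
        _ = ((4 * k) ^ ν * (Γ.posConst A * Γ.posConst B)) * (κ * (3 * κ) ^ (A.nodes + B.nodes)) *
          2 ^ (Γ.edgesIn (BinTree.graft A B).support).card *
          L ^ (Γ.null d A.clusters + Γ.null d B.clusters) * (2 : ℝ) ^ (-(m : ℤ) * D) := by
            rw [hz, Γ.card_edgesIn_graft hd, growth, ← ha, ← hν, ← hk,
              div_eq_mul_one_div (4 * k) (2 ^ m), mul_pow (4 * k)]
            simp only [pow_add]
            ring
        _ ≤ _ := by
            gcongr
            exact Γ.posConst_graft hd
    rw [treeSum]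
    refine (Finset.sum_le_sum hterm).trans ?_
    rw [← Finset.mul_sum, Γ.null_clusters_graft d hd, pow_add L]
    set p := if Γ.degBar d (BinTree.graft A B).support = 0 then 1 else 0 with hp
    have hs := sum_Icc_zpow_le (D := D) (n := n) (N := N)
      ((by positivity : (0 : ℤ) ≤ Γ.posCount (.graft A B)).trans (h.posCount_le_excess hZ hT hsub))
      hL hN p (fun h0 => by rw [hp, if_pos (h.degBar_eq_zero hZ hT hsub h0)])
    have hpAB := zero_le_one.trans (Γ.one_le_posConst (.graft A B))
    refine (mul_le_mul_of_nonneg_left hs (by positivity)).trans (le_of_eq ?_)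
    rw [BinTree.nodes, pow_succ]
    ring

end Diagram

open MeasureTheory
open scoped ENNReal

/-! ### Integration over configurations of points on the torus -/

section Shift

variable {d : ℕ} {V : Type*} [Fintype V]

theorem one_le_volume_torus : 1 ≤ volume (Set.univ : Set (Torus d)) := by
  rw [volume_pi, Measure.pi_univ]
  simp only [AddCircle.measure_univ]
  refine Finset.one_le_prod' fun _ _ => ?_
  rw [← ENNReal.ofReal_one]
  exact ENNReal.ofReal_le_ofReal (by linarith [Real.pi_gt_three])

/-- Integrating out the relative position of two points, when the other factor is invariant under
translations of the points of `B`. -/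
theorem lintegral_mul_sub_le [DecidableEq V] {B : Finset V} {i j : V} (hi : i ∉ B) (hj : j ∈ B)
    {G : (V → Torus d) → ℝ≥0∞} (hG : Measurable G)
    (hinv : ∀ (a : Torus d) x, G (x + fun v => if v ∈ B then a else 0) = G x)
    {g : Torus d → ℝ≥0∞} (hg : Measurable g) :
    ∫⁻ x, G x * g (x j - x i) ≤ (∫⁻ y, g y) * ∫⁻ x, G x := by
  have hsh : ∀ a : Torus d, ∫⁻ x : V → Torus d, G x * g (x j - x i) =
      ∫⁻ x : V → Torus d, G x * g (a + (x j - x i)) := fun a => by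
    rw [← lintegral_add_left_eq_self _ (fun v => if v ∈ B then a else 0)]
    refine lintegral_congr fun x => ?_
    rw [add_comm, hinv]
    congr 2
    simp only [Pi.add_apply, if_pos hj, if_neg hi, add_zero]
    abel
  have hmeas : Measurable (Function.uncurry
      fun (a : Torus d) (x : V → Torus d) => G x * g (a + (x j - x i))) := by
    fun_prop
  calc ∫⁻ x, G x * g (x j - x i)
      ≤ volume (Set.univ : Set (Torus d)) * ∫⁻ x : V → Torus d, G x * g (x j - x i) :=
        le_mul_of_one_le_left' one_le_volume_torus
    _ = ∫⁻ _ : Torus d, ∫⁻ x : V → Torus d, G x * g (x j - x i) := by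
        rw [lintegral_const, mul_comm]
    _ = ∫⁻ a : Torus d, ∫⁻ x : V → Torus d, G x * g (a + (x j - x i)) :=
        lintegral_congr hsh
    _ = ∫⁻ x : V → Torus d, ∫⁻ a : Torus d, G x * g (a + (x j - x i)) :=
        lintegral_lintegral_swap hmeas.aemeasurable
    _ = ∫⁻ x : V → Torus d, G x * ∫⁻ y, g y := by
        refine lintegral_congr fun x => ?_
        rw [lintegral_const_mul _ (by fun_prop), lintegral_add_right_eq_self g]
    _ = _ := by rw [lintegral_mul_const _ hG, mul_comm]

end Shift

section Ball

variable {d : ℕ}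

/-- The indicator function of the ball of radius `π 2⁻ᵐ` for the maximum norm. -/
def ballInd (m : ℕ) : Torus d → ℝ≥0∞ :=
  (Metric.closedBall 0 (Real.pi / 2 ^ m)).indicator 1

theorem measurable_ballInd (m : ℕ) : Measurable (ballInd (d := d) m) :=
  measurable_one.indicator Metric.isClosed_closedBall.measurableSet

theorem ballInd_eq_one {m : ℕ} {y : Torus d} (h : ‖y‖ ≤ Real.pi / 2 ^ m) : ballInd m y = 1 := by
  rw [ballInd, Set.indicator_of_mem (by simpa using h), Pi.one_apply]

theorem lintegral_ballInd_le (m : ℕ) :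
    ∫⁻ y : Torus d, ballInd m y ≤ ENNReal.ofReal ((2 * Real.pi) ^ d / 2 ^ (d * m)) := by
  have hpos : (0 : ℝ) ≤ Real.pi / 2 ^ m := by positivity
  rw [ballInd, lintegral_indicator_one Metric.isClosed_closedBall.measurableSet, volume_pi,
    Measure.pi_closedBall _ _ hpos]
  calc ∏ i : Fin d, volume (Metric.closedBall ((0 : Torus d) i) (Real.pi / 2 ^ m))
      ≤ ∏ _i : Fin d, ENNReal.ofReal (2 * (Real.pi / 2 ^ m)) := by
        refine Finset.prod_le_prod' fun i _ => ?_
        rw [AddCircle.volume_closedBall]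
        exact ENNReal.ofReal_le_ofReal (min_le_right _ _)
    _ = _ := by
        rw [Finset.prod_const, Finset.card_univ, Fintype.card_fin,
          ← ENNReal.ofReal_pow (by positivity)]
        congr 1
        rw [← mul_div_assoc, div_pow, ← pow_mul, mul_comm m d]

end Ball

namespace Diagram

variable {𝔗 : Set ℝ} {V E : Type*} [Fintype E] (Γ : Diagram 𝔗 V E) {d : ℕ}

/-- The majorant of the integrand contributed by the tree `T`: the sum over all scale labellings
of `T` with root label at least `n` and over all choices of linking edges. -/
def majorant (N : ℕ) : BinTree V → ℕ → (V → Torus d) → ℝ≥0∞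
  | .leaf v, n, _ => ENNReal.ofReal ((1 / 2) ^ (n * Γ.posCount (.leaf v)))
  | .graft A B, n, x => ∑ m ∈ Finset.Icc n N, ENNReal.ofReal (Γ.growth A B m) *
      ((if m = 0 then 1 else 0) +
        ∑ e ∈ Γ.cross A.support B.support, ballInd m (x (Γ.tgt e) - x (Γ.src e))) *
      (majorant N A m x * majorant N B m x)

theorem measurable_majorant (N : ℕ) (T : BinTree V) (n : ℕ) :
    Measurable (Γ.majorant (d := d) N T n) := by
  induction T generalizing n with
  | leaf v => exact measurable_const
  | graft A B hA hB =>
    change Measurable fun x => Γ.majorant N (.graft A B) n x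
    simp only [majorant]
    refine Finset.measurable_sum _ fun m _ => ?_
    refine (measurable_const.mul (measurable_const.add
      (Finset.measurable_sum _ fun e _ => ?_))).mul ((hA m).mul (hB m))
    exact (measurable_ballInd m).comp (by fun_prop)

theorem dependsOn_majorant (N : ℕ) (T : BinTree V) (n : ℕ) :
    DependsOn (Γ.majorant (d := d) N T n) T.support := by
  induction T generalizing n with
  | leaf v => intro x y _; rfl
  | graft A B hA hB =>
    intro x y h
    have h' : ∀ v, v ∈ A.support ∨ v ∈ B.support → x v = y v :=
      fun v hv => h v (Finset.mem_coe.2 (BinTree.mem_support_graft.2 hv))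
    unfold majorant
    refine Finset.sum_congr rfl fun m _ => ?_
    rw [hA m fun v hv => h' v (Or.inl hv), hB m fun v hv => h' v (Or.inr hv)]
    congr 3
    refine Finset.sum_congr rfl fun e he => ?_
    rcases Γ.mem_cross.1 he with ⟨h1, h2⟩ | ⟨h1, h2⟩
    · rw [h' _ (Or.inl h1), h' _ (Or.inr h2)]
    · rw [h' _ (Or.inr h1), h' _ (Or.inl h2)]

theorem majorant_translate (N : ℕ) (T : BinTree V) (n : ℕ) (a : Torus d) (x : V → Torus d) :
    Γ.majorant N T n (fun v => x v + a) = Γ.majorant N T n x := by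
  induction T generalizing n with
  | leaf v => rfl
  | graft A B hA hB => simp only [majorant, hA, hB, add_sub_add_right_eq_sub]

theorem majorant_shift_self [DecidableEq V] (N : ℕ) (T : BinTree V) (n : ℕ) (a : Torus d)
    (x : V → Torus d) :
    Γ.majorant N T n (x + fun v => if v ∈ T.support then a else 0) = Γ.majorant N T n x := by
  rw [← Γ.majorant_translate N T n a x]
  refine Γ.dependsOn_majorant N T n fun v hv => ?_
  rw [Pi.add_apply, if_pos (Finset.mem_coe.1 hv)]

theorem majorant_shift_of_disjoint [DecidableEq V] (N : ℕ) (T : BinTree V) (n : ℕ)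
    {U : Finset V} (h : Disjoint T.support U) (a : Torus d) (x : V → Torus d) :
    Γ.majorant N T n (x + fun v => if v ∈ U then a else 0) = Γ.majorant N T n x := by
  refine Γ.dependsOn_majorant N T n fun v hv => ?_
  rw [Pi.add_apply, if_neg (Finset.disjoint_left.1 h (Finset.mem_coe.1 hv)), add_zero]

theorem posCount_congr {T T' : BinTree V} (h : T.SwapEquiv T') : Γ.posCount T = Γ.posCount T' := by
  induction h with
  | leaf v => rfl
  | congr h1 h2 ih1 ih2 => simp only [posCount, ih1, ih2, h1.support_eq, h2.support_eq]
  | @swap A A' B B' h1 h2 ih1 ih2 =>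
    simp only [posCount, ih1, ih2, h1.support_eq, h2.support_eq]
    rw [newPos_comm, add_comm (Γ.posCount B')]

theorem growth_comm (A B : BinTree V) (m : ℕ) : Γ.growth A B m = Γ.growth B A m := by
  rw [growth, growth, newPos_comm, cross_comm, add_comm (Γ.posCount A),
    add_comm (A.support.card : ℝ)]

theorem growth_congr {A A' B B' : BinTree V} (hA : A.SwapEquiv A') (hB : B.SwapEquiv B') (m : ℕ) :
    Γ.growth A B m = Γ.growth A' B' m := by
  rw [growth, growth, hA.support_eq, hB.support_eq, Γ.posCount_congr hA, Γ.posCount_congr hB]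

theorem majorant_congr (N : ℕ) {T T' : BinTree V} (h : T.SwapEquiv T') (n : ℕ)
    (x : V → Torus d) : Γ.majorant N T n x = Γ.majorant N T' n x := by
  induction h generalizing n with
  | leaf v => rfl
  | congr h1 h2 ih1 ih2 =>
    simp only [majorant, ih1, ih2, Γ.growth_congr h1 h2, h1.support_eq, h2.support_eq]
  | swap h1 h2 ih1 ih2 =>
    simp only [majorant, ih1, ih2, Γ.growth_congr h1 h2, h1.support_eq, h2.support_eq]
    refine Finset.sum_congr rfl fun m _ => ?_
    rw [growth_comm, cross_comm, mul_comm (Γ.majorant N _ m x)]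

theorem lintegral_mul_majorant_le [Fintype V] (N : ℕ) {T : BinTree V} (hT : T.labels.Nodup) (n : ℕ)
    {H : (V → Torus d) → ℝ≥0∞} (hH : Measurable H) (hdep : DependsOn H ((T.support : Set V)ᶜ)) :
    ∫⁻ x, H x * Γ.majorant N T n x ≤
      ENNReal.ofReal (Γ.treeSum d ((2 * Real.pi) ^ d) N T n) * ∫⁻ x, H x := by
  classical
  set κ : ℝ := (2 * Real.pi) ^ d with hκ
  have hκ0 : 0 ≤ κ := by positivity
  induction T generalizing n H with
  | leaf v => simp only [majorant, treeSum]; rw [lintegral_mul_const _ hH, mul_comm]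
  | graft A B ihA ihB =>
    obtain ⟨hA, hB, hd⟩ := BinTree.nodup_graft hT
    set c := Γ.cross A.support B.support with hc
    have hHs : ∀ U : Finset V, U ⊆ (BinTree.graft A B).support → ∀ (a : Torus d) x,
        H (x + fun v => if v ∈ U then a else 0) = H x := fun U hU a x => hdep fun v hv => by
      rw [Pi.add_apply, if_neg (fun h => hv (Finset.mem_coe.2 (hU h))), add_zero]
    have hsA : A.support ⊆ (BinTree.graft A B).support :=
      fun v hv => BinTree.mem_support_graft.2 (Or.inl hv)
    have hsB : B.support ⊆ (BinTree.graft A B).support :=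
      fun v hv => BinTree.mem_support_graft.2 (Or.inr hv)
    have hstep : ∀ m, ∫⁻ x, H x * (Γ.majorant N A m x * Γ.majorant N B m x) ≤
        ENNReal.ofReal (Γ.treeSum d κ N A m * Γ.treeSum d κ N B m) * ∫⁻ x, H x := by
      intro m
      have h1 := ihA hA m (H := fun x => H x * Γ.majorant N B m x)
        (hH.mul (Γ.measurable_majorant N B m)) (fun x y h => by
          have e1 := hdep (x := x) (y := y) fun v hv => h v fun hvA => hv (hsA hvA)
          have e2 := Γ.dependsOn_majorant N B m (x := x) (y := y) fun v hv =>
            h v fun hvA => Finset.disjoint_left.1 hd hvA hv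
          simp only [e1, e2])
      have h2 := ihB hB m hH (fun x y h => hdep fun v hv => h v fun hvB => hv (hsB hvB))
      calc _ = ∫⁻ x, H x * Γ.majorant N B m x * Γ.majorant N A m x :=
            lintegral_congr fun x => by ring
        _ ≤ ENNReal.ofReal (Γ.treeSum d κ N A m) *
            (ENNReal.ofReal (Γ.treeSum d κ N B m) * ∫⁻ x, H x) := h1.trans (by gcongr)
        _ = _ := by rw [ENNReal.ofReal_mul (Γ.treeSum_nonneg d hκ0 N A m), mul_assoc]
    have hlink : ∀ m, ∀ e ∈ c,
        ∫⁻ x, H x * (Γ.majorant N A m x * Γ.majorant N B m x) *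
          ballInd m (x (Γ.tgt e) - x (Γ.src e)) ≤
        ENNReal.ofReal (κ / 2 ^ (d * m)) *
          ∫⁻ x, H x * (Γ.majorant N A m x * Γ.majorant N B m x) := by
      intro m e he
      have hG : Measurable fun x : V → Torus d =>
          H x * (Γ.majorant N A m x * Γ.majorant N B m x) :=
        hH.mul ((Γ.measurable_majorant N A m).mul (Γ.measurable_majorant N B m))
      rcases Γ.mem_cross.1 he with ⟨h1, h2⟩ | ⟨h1, h2⟩
      · refine (lintegral_mul_sub_le (Finset.disjoint_left.1 hd h1) h2 hG ?_
          (measurable_ballInd m)).trans (by gcongr; exact lintegral_ballInd_le m)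
        intro a x
        rw [hHs _ hsB, Γ.majorant_shift_of_disjoint N A m hd, Γ.majorant_shift_self N B m]
      · refine (lintegral_mul_sub_le (Finset.disjoint_right.1 hd h1) h2 hG ?_
          (measurable_ballInd m)).trans (by gcongr; exact lintegral_ballInd_le m)
        intro a x
        rw [hHs _ hsA, Γ.majorant_shift_of_disjoint N B m hd.symm, Γ.majorant_shift_self N A m]
    have hmeas : ∀ m, ∀ e, Measurable fun x : V → Torus d =>
        H x * (Γ.majorant N A m x * Γ.majorant N B m x) *
          ballInd m (x (Γ.tgt e) - x (Γ.src e)) := fun m e =>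
      (hH.mul ((Γ.measurable_majorant N A m).mul (Γ.measurable_majorant N B m))).mul
        ((measurable_ballInd m).comp (by fun_prop))
    have hterm : ∀ m, ∫⁻ x, ENNReal.ofReal (Γ.growth A B m) *
        ((if m = 0 then 1 else 0) * (H x * (Γ.majorant N A m x * Γ.majorant N B m x)) +
          ∑ e ∈ c, H x * (Γ.majorant N A m x * Γ.majorant N B m x) *
            ballInd m (x (Γ.tgt e) - x (Γ.src e))) ≤
        ENNReal.ofReal (Γ.growth A B m * ((if m = 0 then 1 else 0) + c.card *
          (κ / 2 ^ (d * m))) * (Γ.treeSum d κ N A m * Γ.treeSum d κ N B m)) * ∫⁻ x, H x := by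
      intro m
      have hG : Measurable fun x : V → Torus d =>
          H x * (Γ.majorant N A m x * Γ.majorant N B m x) :=
        hH.mul ((Γ.measurable_majorant N A m).mul (Γ.measurable_majorant N B m))
      have hadd : Measurable fun x : V → Torus d =>
          (if m = 0 then 1 else 0) * (H x * (Γ.majorant N A m x * Γ.majorant N B m x)) +
            ∑ e ∈ c, H x * (Γ.majorant N A m x * Γ.majorant N B m x) *
              ballInd m (x (Γ.tgt e) - x (Γ.src e)) :=
        (hG.const_mul _).add (Finset.measurable_sum _ fun e _ => hmeas m e)
      rw [lintegral_const_mul _ hadd, lintegral_add_left (hG.const_mul _), lintegral_const_mul _ hG,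
        lintegral_finsetSum _ fun e _ => hmeas m e]
      have hif : ((if m = 0 then 1 else 0 : ℝ≥0∞)) = ENNReal.ofReal (if m = 0 then 1 else 0) := by
        split_ifs <;> simp
      have hif0 : (0 : ℝ) ≤ if m = 0 then 1 else 0 := by split_ifs <;> norm_num
      calc _ ≤ ENNReal.ofReal (Γ.growth A B m) *
            (ENNReal.ofReal (if m = 0 then 1 else 0) *
              (∫⁻ x, H x * (Γ.majorant N A m x * Γ.majorant N B m x)) +
            ∑ _e ∈ c, ENNReal.ofReal (κ / 2 ^ (d * m)) *
              ∫⁻ x, H x * (Γ.majorant N A m x * Γ.majorant N B m x)) := by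
            rw [hif]
            gcongr with e he
            exact hlink m e he
        _ = ENNReal.ofReal (Γ.growth A B m) *
            ENNReal.ofReal ((if m = 0 then 1 else 0) + c.card * (κ / 2 ^ (d * m))) *
              (∫⁻ x, H x * (Γ.majorant N A m x * Γ.majorant N B m x)) := by
            rw [Finset.sum_const, nsmul_eq_mul, ENNReal.ofReal_add hif0 (by positivity),
              ENNReal.ofReal_mul (Nat.cast_nonneg _), ENNReal.ofReal_natCast]
            ring
        _ ≤ ENNReal.ofReal (Γ.growth A B m) *
            ENNReal.ofReal ((if m = 0 then 1 else 0) + c.card * (κ / 2 ^ (d * m))) *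
              (ENNReal.ofReal (Γ.treeSum d κ N A m * Γ.treeSum d κ N B m) * ∫⁻ x, H x) := by
            gcongr
            exact hstep m
        _ = _ := by
            rw [← mul_assoc, ENNReal.ofReal_mul (mul_nonneg (Γ.growth_nonneg A B m)
              (by positivity)), ENNReal.ofReal_mul (Γ.growth_nonneg A B m)]
    calc _ = ∫⁻ x, ∑ m ∈ Finset.Icc n N, ENNReal.ofReal (Γ.growth A B m) *
        ((if m = 0 then 1 else 0) * (H x * (Γ.majorant N A m x * Γ.majorant N B m x)) +
          ∑ e ∈ c, H x * (Γ.majorant N A m x * Γ.majorant N B m x) *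
            ballInd m (x (Γ.tgt e) - x (Γ.src e))) := by
          refine lintegral_congr fun x => ?_
          rw [majorant, Finset.mul_sum]
          refine Finset.sum_congr rfl fun m _ => ?_
          rw [← Finset.mul_sum, ← hc]
          ring
      _ ≤ ∑ m ∈ Finset.Icc n N, ENNReal.ofReal (Γ.growth A B m * ((if m = 0 then 1 else 0) +
          c.card * (κ / 2 ^ (d * m))) * (Γ.treeSum d κ N A m * Γ.treeSum d κ N B m)) *
            ∫⁻ x, H x := by
          rw [lintegral_finsetSum]
          · exact Finset.sum_le_sum fun m _ => hterm m
          · intro m _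
            exact (((hH.mul ((Γ.measurable_majorant N A m).mul
              (Γ.measurable_majorant N B m))).const_mul _).add
              (Finset.measurable_sum _ fun e _ => hmeas m e)).const_mul _
      _ = _ := by
          rw [← Finset.sum_mul, treeSum, ENNReal.ofReal_sum_of_nonneg]
          intro m _
          exact mul_nonneg (mul_nonneg (Γ.growth_nonneg A B m) (by positivity))
            (mul_nonneg (Γ.treeSum_nonneg d hκ0 N A m) (Γ.treeSum_nonneg d hκ0 N B m))

end Diagram

section Scale

variable {d : ℕ}

theorem norm_le_pi (y : Torus d) : ‖y‖ ≤ Real.pi := by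
  refine (pi_norm_le_iff_of_nonneg Real.pi_pos.le).2 fun i => ?_
  refine (AddCircle.norm_le_half_period (2 * Real.pi) Real.two_pi_pos.ne').trans (le_of_eq ?_)
  rw [abs_of_pos Real.two_pi_pos]
  ring

/-- The largest `s ≤ N` such that `y` lies in the ball of radius `π 2⁻ˢ`. -/
def scale (N : ℕ) (y : Torus d) : ℕ :=
  open Classical in Nat.findGreatest (fun s => ‖y‖ ≤ Real.pi / 2 ^ s) N

theorem scale_le (N : ℕ) (y : Torus d) : scale N y ≤ N := Nat.findGreatest_le _

theorem norm_le_scale (N : ℕ) (y : Torus d) : ‖y‖ ≤ Real.pi / 2 ^ scale N y := by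
  classical
  have h0 : ‖y‖ ≤ Real.pi / 2 ^ 0 := by simpa using norm_le_pi y
  unfold scale
  convert Nat.findGreatest_spec (P := fun s => ‖y‖ ≤ Real.pi / 2 ^ s) (Nat.zero_le N) h0

theorem inv_two_pow_scale_le {N : ℕ} {ε : ℝ} (hε : 1 / 2 ^ (N + 1) ≤ ε) (y : Torus d) :
    1 / 2 ^ (scale N y + 1) ≤ ‖y‖ + ε := by
  classical
  rcases (scale_le N y).eq_or_lt with h | h
  · rw [h]
    linarith [norm_nonneg y]
  · have h1 : ¬ ‖y‖ ≤ Real.pi / 2 ^ (scale N y + 1) := by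
      unfold scale at h ⊢
      convert Nat.findGreatest_is_greatest (P := fun s => ‖y‖ ≤ Real.pi / 2 ^ s)
        (Nat.lt_succ_self _) (Nat.succ_le_of_lt h)
    have h2 : (1 : ℝ) / 2 ^ (scale N y + 1) ≤ Real.pi / 2 ^ (scale N y + 1) := by
      gcongr
      linarith [Real.pi_gt_three]
    have h3 : (0 : ℝ) ≤ ε := le_trans (by positivity) hε
    linarith

theorem norm_le_torusNorm (y : Torus d) : ‖y‖ ≤ torusNorm y := by
  refine (pi_norm_le_iff_of_nonneg (Real.sqrt_nonneg _)).2 fun i => Real.le_sqrt_of_sq_le ?_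
  exact Finset.single_le_sum (f := fun i => ‖y i‖ ^ 2) (fun j _ => sq_nonneg _) (Finset.mem_univ i)

theorem torusNorm_le (y : Torus d) : torusNorm y ≤ d * ‖y‖ := by
  refine Real.sqrt_le_iff.2 ⟨by positivity, ?_⟩
  calc ∑ i, ‖y i‖ ^ 2 ≤ ∑ _i : Fin d, ‖y‖ ^ 2 := by
        gcongr with i
        exact norm_le_pi_norm y i
    _ = d * ‖y‖ ^ 2 := by simp
    _ ≤ (d * ‖y‖) ^ 2 := by
        rw [mul_pow]
        gcongr
        exact_mod_cast Nat.le_self_pow two_ne_zero d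

end Scale

theorem prod_le_of_le_one {ι : Type*} {s : Finset ι} {f : ι → ℝ} (h0 : ∀ i ∈ s, 0 ≤ f i)
    (h1 : ∀ i ∈ s, f i ≤ 1) {i : ι} (hi : i ∈ s) : ∏ j ∈ s, f j ≤ f i := by
  classical
  rw [← Finset.mul_prod_erase s f hi]
  refine mul_le_of_le_one_right (h0 i hi) (Finset.prod_le_one ?_ ?_)
  · exact fun j hj => h0 j (Finset.mem_of_mem_erase hj)
  · exact fun j hj => h1 j (Finset.mem_of_mem_erase hj)

namespace Diagram

variable {𝔗 : Set ℝ} {V E : Type*} (Γ : Diagram 𝔗 V E) {d : ℕ}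

/-- The scale of the distance between the endpoints of an edge. -/
def edgeScale (N : ℕ) (x : V → Torus d) (e : E) : ℕ := scale N (x (Γ.tgt e) - x (Γ.src e))

/-- The gain from an edge of positive type. -/
def posFactor (ε : ℝ) (x : V → Torus d) (e : E) : ℝ :=
  open Classical in
  if 0 < (Γ.type e : ℝ) then min 1 (‖x (Γ.tgt e) - x (Γ.src e)‖ + ε) else 1

theorem posFactor_nonneg {ε : ℝ} (hε : 0 ≤ ε) (x : V → Torus d) (e : E) :
    0 ≤ Γ.posFactor ε x e := by
  unfold posFactor
  split_ifs <;> positivity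

theorem posFactor_le_one (ε : ℝ) (x : V → Torus d) (e : E) : Γ.posFactor ε x e ≤ 1 := by
  unfold posFactor
  split_ifs
  · exact min_le_left _ _
  · exact le_rfl

theorem posFactor_le {ε : ℝ} {x : V → Torus d} {e : E} (h : 0 < (Γ.type e : ℝ)) :
    Γ.posFactor ε x e ≤ ‖x (Γ.tgt e) - x (Γ.src e)‖ + ε := by
  rw [posFactor, if_pos h]
  exact min_le_right _ _

variable [Fintype E]

variable {Γ} in
theorem Linked.norm_sub_le {N : ℕ} {x : V → Torus d} {T : BinTree V} {n : ℕ}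
    (h : Γ.Linked (Γ.edgeScale N x) N T n) {i j : V} (hi : i ∈ T.support) (hj : j ∈ T.support) :
    ‖x i - x j‖ ≤ T.nodes * (Real.pi / 2 ^ n) := by
  induction T generalizing n i j with
  | leaf v =>
    rw [BinTree.support_leaf, Finset.mem_singleton] at hi hj
    simp [hi, hj, BinTree.nodes]
  | graft A B ihA ihB =>
    obtain ⟨m, hnm, -, hA, hB, -, hm⟩ := h
    rw [BinTree.nodes]
    push_cast
    have hpos : (0 : ℝ) < Real.pi / 2 ^ m := by positivity
    have hAn : (0 : ℝ) ≤ A.nodes * (Real.pi / 2 ^ m) := by positivity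
    have hBn : (0 : ℝ) ≤ B.nodes * (Real.pi / 2 ^ m) := by positivity
    have hmono : (A.nodes + B.nodes + 1 : ℝ) * (Real.pi / 2 ^ m) ≤
        (A.nodes + B.nodes + 1 : ℝ) * (Real.pi / 2 ^ n) := by
      gcongr
      norm_num
    refine le_trans ?_ hmono
    rcases hm with rfl | ⟨e, he, hs⟩
    · rw [pow_zero, div_one] at *
      linarith [norm_le_pi (x i - x j)]
    · have he' : ‖x (Γ.tgt e) - x (Γ.src e)‖ ≤ Real.pi / 2 ^ m := by
        rw [← hs]; exact norm_le_scale N _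
      obtain ⟨a, ha, b, hb, hab⟩ : ∃ a ∈ A.support, ∃ b ∈ B.support,
          ‖x a - x b‖ ≤ Real.pi / 2 ^ m := by
        rcases Γ.mem_cross.1 he with ⟨h1, h2⟩ | ⟨h1, h2⟩
        · exact ⟨_, h1, _, h2, by rwa [norm_sub_rev]⟩
        · exact ⟨_, h2, _, h1, he'⟩
      have key : ∀ i ∈ A.support, ∀ j ∈ B.support,
          ‖x i - x j‖ ≤ (A.nodes + B.nodes + 1 : ℝ) * (Real.pi / 2 ^ m) := by
        intro i hi j hj
        have e1 : x i - x j = (x i - x a) + (x a - x b) + (x b - x j) := by abel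
        have := norm_add₃_le (a := x i - x a) (b := x a - x b) (c := x b - x j)
        rw [← e1] at this
        linarith [ihA hA hi ha, ihB hB hb hj]
      rcases BinTree.mem_support_graft.1 hi with hi | hi <;>
        rcases BinTree.mem_support_graft.1 hj with hj | hj
      · linarith [ihA hA hi hj]
      · exact key i hi j hj
      · rw [norm_sub_rev]
        exact key j hj i hi
      · linarith [ihB hB hi hj]

variable {Γ} in
theorem Linked.prod_le_majorant [Fintype V] (hΓ : Γ.NonNegative d) (hZ : Γ.IntegerTypes) {N : ℕ}
    {ε : ℝ} (hε : 0 ≤ ε) (hεN : ε ≤ 1 / 2 ^ N) {x : V → Torus d} {T : BinTree V}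
    (hT : T.labels.Nodup) (hsub : T.support ⊆ Γ.inner) {n : ℕ}
    (h : Γ.Linked (Γ.edgeScale N x) N T n) :
    ENNReal.ofReal (∏ e ∈ Γ.edgesIn T.support,
      2 ^ (Γ.edgeScale N x e * Γ.negPart e) * Γ.posFactor ε x e) ≤ Γ.majorant N T n x := by
  classical
  have hθ0 := Γ.posFactor_nonneg hε x
  have hθ1 := Γ.posFactor_le_one ε x
  have hle : ∀ m ≤ N, ε ≤ 1 / 2 ^ m := fun m hm => hεN.trans (by gcongr; norm_num)
  induction T generalizing n with
  | leaf v =>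
    rw [majorant]
    refine ENNReal.ofReal_le_ofReal ?_
    have hneg : ∀ e ∈ Γ.edgesIn (BinTree.leaf v).support, Γ.negPart e = 0 := by
      have h1 := hΓ.sum_negPart_le hZ (BinTree.leaf v).support_nonempty hsub
      rw [BinTree.card_support hT, BinTree.nodes] at h1
      simp only [zero_add, Nat.cast_one, sub_self, mul_zero] at h1
      have h2 : ∑ e ∈ Γ.edgesIn (BinTree.leaf v).support, Γ.negPart e = 0 := by
        exact_mod_cast le_antisymm h1 (Nat.cast_nonneg _)
      exact Finset.sum_eq_zero_iff.1 h2
    have h1 : ∏ e ∈ Γ.edgesIn (BinTree.leaf v).support,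
        2 ^ (Γ.edgeScale N x e * Γ.negPart e) * Γ.posFactor ε x e =
        ∏ e ∈ Γ.edgesIn (BinTree.leaf v).support, Γ.posFactor ε x e :=
      Finset.prod_congr rfl fun e he => by rw [hneg e he, mul_zero, pow_zero, one_mul]
    rw [h1, posCount]
    split_ifs with hp
    · obtain ⟨e, he, ht⟩ := hp
      refine (prod_le_of_le_one (fun e _ => hθ0 e) (fun e _ => hθ1 e)
        (i := e) (by rwa [BinTree.support_leaf])).trans ?_
      refine (Γ.posFactor_le ht).trans ?_
      rw [mem_edgesIn, Finset.mem_singleton, Finset.mem_singleton] at he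
      rw [he.1, he.2, sub_self, norm_zero, zero_add, mul_one, one_div_pow]
      exact hle n h
    · rw [mul_zero, pow_zero]
      exact Finset.prod_le_one (fun e _ => hθ0 e) (fun e _ => hθ1 e)
  | graft A B ihA ihB =>
    obtain ⟨hA, hB, hd⟩ := BinTree.nodup_graft hT
    have hsA : A.support ⊆ Γ.inner := fun v hv => hsub (BinTree.mem_support_graft.2 (Or.inl hv))
    have hsB : B.support ⊆ Γ.inner := fun v hv => hsub (BinTree.mem_support_graft.2 (Or.inr hv))
    obtain ⟨m, hnm, hmN, hlA, hlB, hmax, hm⟩ := h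
    have hlm : Γ.Linked (Γ.edgeScale N x) N (.graft A B) m := ⟨m, le_rfl, hmN, hlA, hlB, hmax, hm⟩
    have hθ : ∏ e ∈ Γ.cross A.support B.support, Γ.posFactor ε x e ≤
        (4 * (A.support.card + B.support.card) / 2 ^ m) ^
          Γ.newPos (Γ.posCount A + Γ.posCount B) A.support B.support := by
      rcases Γ.newPos_eq_zero_or (Γ.posCount A + Γ.posCount B) A.support B.support
        with h0 | ⟨h1, -, e, he, ht⟩
      · rw [h0, pow_zero]
        exact Finset.prod_le_one (fun e _ => hθ0 e) (fun e _ => hθ1 e)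
      · rw [h1, pow_one]
        refine (prod_le_of_le_one (fun e _ => hθ0 e) (fun e _ => hθ1 e) he).trans ?_
        refine (Γ.posFactor_le ht).trans ?_
        have hmem : Γ.tgt e ∈ (BinTree.graft A B).support ∧
            Γ.src e ∈ (BinTree.graft A B).support := by
          rw [BinTree.mem_support_graft, BinTree.mem_support_graft]
          rcases Γ.mem_cross.1 he with h | h
          · exact ⟨Or.inr h.2, Or.inl h.1⟩
          · exact ⟨Or.inl h.2, Or.inr h.1⟩
        have h2 := hlm.norm_sub_le hmem.1 hmem.2
        rw [BinTree.nodes] at h2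
        rw [BinTree.card_support hA, BinTree.card_support hB]
        have h3 := hle m hmN
        push_cast at h2 ⊢
        have h4 : (A.nodes + B.nodes + 1 : ℝ) * (Real.pi / 2 ^ m) ≤
            (A.nodes + B.nodes + 1 : ℝ) * (4 / 2 ^ m) := by
          gcongr
          exact Real.pi_le_four
        have h5 : (4 * ((A.nodes : ℝ) + 1 + (B.nodes + 1)) / 2 ^ m) =
            (A.nodes + B.nodes + 1 : ℝ) * (4 / 2 ^ m) + 4 * (1 / 2 ^ m) := by ring
        have h6 : (0 : ℝ) < 1 / 2 ^ m := by positivity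
        rw [h5]
        linarith
    have hcross : ∏ e ∈ Γ.cross A.support B.support,
        2 ^ (Γ.edgeScale N x e * Γ.negPart e) * Γ.posFactor ε x e ≤ Γ.growth A B m := by
      rw [Finset.prod_mul_distrib, growth, Finset.mul_sum, ← Finset.prod_pow_eq_pow_sum]
      refine mul_le_mul ?_ hθ (Finset.prod_nonneg fun e _ => hθ0 e) (by positivity)
      gcongr with e he
      · norm_num
      · exact hmax e he
    have hprod : ∀ S : Finset E, 0 ≤ ∏ e ∈ S,
        2 ^ (Γ.edgeScale N x e * Γ.negPart e) * Γ.posFactor ε x e := fun S =>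
      Finset.prod_nonneg fun e _ => mul_nonneg (by positivity) (hθ0 e)
    have hlink : 1 ≤ (if m = 0 then 1 else 0 : ℝ≥0∞) + ∑ e ∈ Γ.cross A.support B.support,
        ballInd m (x (Γ.tgt e) - x (Γ.src e)) := by
      rcases hm with hm | ⟨e, he, hs⟩
      · rw [if_pos hm]
        exact le_self_add
      · refine le_add_left ?_
        have h1 : ballInd m (x (Γ.tgt e) - x (Γ.src e)) = 1 := by
          refine ballInd_eq_one ?_
          rw [← hs]
          exact norm_le_scale N _
        rw [← h1]
        exact Finset.single_le_sum (f := fun e => ballInd m (x (Γ.tgt e) - x (Γ.src e)))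
          (fun _ _ => zero_le) he
    rw [majorant]
    refine le_trans ?_ (Finset.single_le_sum (fun _ _ => zero_le)
      (Finset.mem_Icc.2 ⟨hnm, hmN⟩))
    rw [BinTree.support_graft, Γ.prod_edgesIn_union hd, ENNReal.ofReal_mul (hprod _),
      ENNReal.ofReal_mul (hprod _)]
    refine mul_le_mul' ?_ (mul_le_mul' (ihA hA hsA hlA) (ihB hB hsB hlB))
    exact (ENNReal.ofReal_le_ofReal hcross).trans (le_mul_of_one_le_right' hlink)

end Diagram

section Kernel

variable {d : ℕ}

theorem ballInd_neg (m : ℕ) (y : Torus d) : ballInd m (-y) = ballInd m y := by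
  unfold ballInd
  by_cases h : ‖y‖ ≤ Real.pi / 2 ^ m
  · rw [Set.indicator_of_mem (by simpa using h), Set.indicator_of_mem (by simpa using h)]
    rfl
  · rw [Set.indicator_of_notMem (by simpa using h), Set.indicator_of_notMem (by simpa using h)]

/-- A symmetric majorant, uniformly integrable in `N`, of kernels of order `-d + δ`. -/
def dyadicKernel (δ : ℝ) (N : ℕ) (y : Torus d) : ℝ≥0∞ :=
  ∑ s ∈ Finset.range (N + 1), ENNReal.ofReal (((2 : ℝ) ^ ((d : ℝ) - δ)) ^ s) * ballInd s y

theorem measurable_dyadicKernel (δ : ℝ) (N : ℕ) : Measurable (dyadicKernel (d := d) δ N) := by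
  unfold dyadicKernel
  exact Finset.measurable_sum _ fun s _ => (measurable_ballInd s).const_mul _

theorem dyadicKernel_neg (δ : ℝ) (N : ℕ) (y : Torus d) :
    dyadicKernel δ N (-y) = dyadicKernel δ N y := by
  simp only [dyadicKernel, ballInd_neg]

theorem lintegral_dyadicKernel_le {δ : ℝ} (hδ : 0 < δ) (N : ℕ) :
    ∫⁻ y : Torus d, dyadicKernel δ N y ≤
      ENNReal.ofReal ((2 * Real.pi) ^ d * (1 - (2 : ℝ) ^ (-δ))⁻¹) := by
  unfold dyadicKernel
  rw [lintegral_finsetSum _ fun s _ => (measurable_ballInd s).const_mul _]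
  have hr0 : (0 : ℝ) ≤ (2 : ℝ) ^ (-δ) := by positivity
  have hr1 : (2 : ℝ) ^ (-δ) < 1 := Real.rpow_lt_one_of_one_lt_of_neg one_lt_two (by linarith)
  calc _ ≤ ∑ s ∈ Finset.range (N + 1),
        ENNReal.ofReal ((2 * Real.pi) ^ d * ((2 : ℝ) ^ (-δ)) ^ s) := by
        refine Finset.sum_le_sum fun s _ => ?_
        rw [lintegral_const_mul _ (measurable_ballInd s)]
        refine (mul_le_mul_right (lintegral_ballInd_le s) _).trans (le_of_eq ?_)
        rw [← ENNReal.ofReal_mul (by positivity)]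
        congr 1
        rw [sub_eq_add_neg, Real.rpow_add two_pos, Real.rpow_natCast, mul_pow, ← pow_mul]
        field_simp
    _ = ENNReal.ofReal ((2 * Real.pi) ^ d * ∑ s ∈ Finset.range (N + 1), ((2 : ℝ) ^ (-δ)) ^ s) := by
        rw [Finset.mul_sum, ENNReal.ofReal_sum_of_nonneg fun s _ => by positivity]
    _ ≤ _ := by
        refine ENNReal.ofReal_le_ofReal ?_
        gcongr
        rw [← tsum_geometric_of_lt_one hr0 hr1]
        exact (summable_geometric_of_lt_one hr0 hr1).sum_le_tsum _ fun _ _ => by positivity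

theorem torusNorm_nonneg (y : Torus d) : 0 ≤ torusNorm y := Real.sqrt_nonneg _

theorem rpow_torusNorm_le_of_nonneg (hd : 1 ≤ d) {ε t M : ℝ} (hε : ε ∈ Set.Ioo (0 : ℝ) 1)
    (ht : 0 ≤ t) (htM : t ≤ M) (y : Torus d) : (torusNorm y + ε) ^ t ≤ (5 * d : ℝ) ^ M := by
  have hd' : (1 : ℝ) ≤ d := by exact_mod_cast hd
  have h0 := torusNorm_nonneg y
  have h1 : torusNorm y + ε ≤ 5 * d := by
    have := torusNorm_le y
    have := norm_le_pi y
    have := Real.pi_le_four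
    have := hε.2
    nlinarith
  calc _ ≤ (5 * d : ℝ) ^ t := Real.rpow_le_rpow (by linarith [hε.1]) h1 ht
    _ ≤ _ := Real.rpow_le_rpow_of_exponent_le (by linarith) htM

theorem rpow_torusNorm_le_of_one_le (hd : 1 ≤ d) {ε t M : ℝ} (hε : ε ∈ Set.Ioo (0 : ℝ) 1)
    (ht : 1 ≤ t) (htM : t ≤ M) (y : Torus d) :
    (torusNorm y + ε) ^ t ≤ (5 * d : ℝ) ^ M * min 1 (‖y‖ + ε) := by
  have hd' : (1 : ℝ) ≤ d := by exact_mod_cast hd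
  have h0 := torusNorm_nonneg y
  have hn := norm_nonneg y
  have hε0 := hε.1
  have hmin0 : 0 ≤ min 1 (‖y‖ + ε) := le_min zero_le_one (by linarith)
  have h1 : torusNorm y + ε ≤ 5 * d * min 1 (‖y‖ + ε) := by
    have h2 := torusNorm_le y
    have h3 := norm_le_pi y
    have h4 := Real.pi_le_four
    have h5 := hε.2
    rcases min_cases 1 (‖y‖ + ε) with ⟨h, -⟩ | ⟨h, -⟩ <;> rw [h] <;> nlinarith
  calc _ ≤ (5 * d * min 1 (‖y‖ + ε)) ^ t := Real.rpow_le_rpow (by linarith) h1 (by linarith)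
    _ = (5 * d : ℝ) ^ t * (min 1 (‖y‖ + ε)) ^ t := Real.mul_rpow (by positivity) hmin0
    _ ≤ _ := by
      gcongr
      · linarith
      · exact (Real.rpow_le_rpow_of_exponent_ge' hmin0 (min_le_left _ _) zero_le_one ht).trans
          (Real.rpow_one _).le

theorem rpow_torusNorm_le_of_nonpos {ε t : ℝ} {N : ℕ} (hεN : 1 / 2 ^ (N + 1) ≤ ε)
    (ht : t ≤ 0) (htd : -(d : ℝ) ≤ t) (y : Torus d) :
    (torusNorm y + ε) ^ t ≤ 2 ^ d * ((2 : ℝ) ^ (-t)) ^ scale N y := by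
  have h1 : 1 / 2 ^ (scale N y + 1) ≤ torusNorm y + ε :=
    (inv_two_pow_scale_le hεN y).trans (by gcongr; exact norm_le_torusNorm y)
  calc _ ≤ ((1 : ℝ) / 2 ^ (scale N y + 1)) ^ t :=
        Real.rpow_le_rpow_of_nonpos (by positivity) h1 ht
    _ = (2 : ℝ) ^ (-t) * ((2 : ℝ) ^ (-t)) ^ scale N y := by
        rw [one_div, Real.inv_rpow (by positivity), ← Real.rpow_neg (by positivity),
          ← Real.rpow_natCast, ← Real.rpow_mul two_pos.le, ← Real.rpow_natCast ((2 : ℝ) ^ (-t)),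
          ← Real.rpow_mul two_pos.le, ← Real.rpow_add two_pos]
        congr 1
        push_cast
        ring
    _ ≤ _ := by
        gcongr
        rw [← Real.rpow_natCast]
        exact Real.rpow_le_rpow_of_exponent_le one_le_two (by linarith)

theorem abs_le_of_rpow_mul_le {r t k B : ℝ} (hr : 0 < r) (h : r ^ (-t) * |k| ≤ B) :
    |k| ≤ B * r ^ t := by
  have h1 : r ^ t * r ^ (-t) = 1 := by rw [← Real.rpow_add hr, add_neg_cancel, Real.rpow_zero]
  calc |k| = r ^ t * (r ^ (-t) * |k|) := by rw [← mul_assoc, h1, one_mul]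
    _ ≤ r ^ t * B := by gcongr
    _ = _ := mul_comm _ _

/-- The bound for a kernel of integer type on an inner edge. -/
theorem abs_kernel_le_of_int (hd : 1 ≤ d) {ε t M B k : ℝ} (hε : ε ∈ Set.Ioo (0 : ℝ) 1) {N : ℕ}
    (hεN : 1 / 2 ^ (N + 1) ≤ ε) (hB : 0 ≤ B) (htd : -(d : ℝ) ≤ t) (htM : t ≤ M)
    (hintg : ∃ n : ℤ, t = n) {y : Torus d}
    (hk : (torusNorm y + ε) ^ (-t) * |k| ≤ B) :
    |k| ≤ B * (2 ^ d + (5 * d : ℝ) ^ M) * (2 ^ (scale N y * ⌊-t⌋₊) *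
      (open Classical in if 0 < t then min 1 (‖y‖ + ε) else 1)) := by
  have hr : 0 < torusNorm y + ε := by linarith [torusNorm_nonneg y, hε.1]
  refine (abs_le_of_rpow_mul_le hr hk).trans ?_
  rw [mul_assoc B]
  refine mul_le_mul_of_nonneg_left ?_ hB
  have h5 : (0 : ℝ) ≤ (5 * d : ℝ) ^ M := by positivity
  have h2 : (0 : ℝ) ≤ 2 ^ d := by positivity
  obtain ⟨n, rfl⟩ := hintg
  by_cases ht : 0 < (n : ℝ)
  · rw [if_pos ht, Nat.floor_eq_zero.2 (by linarith), mul_zero, pow_zero, one_mul]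
    have h1 : (1 : ℝ) ≤ n := by exact_mod_cast (by exact_mod_cast ht : 0 < n)
    refine (rpow_torusNorm_le_of_one_le hd hε h1 htM y).trans ?_
    gcongr
    · exact le_min zero_le_one (by linarith [norm_nonneg y, hε.1])
    · linarith
  · rw [if_neg ht, mul_one]
    have hn0 : n ≤ 0 := by exact_mod_cast not_lt.1 ht
    obtain ⟨a, rfl⟩ := Int.exists_eq_neg_ofNat hn0
    refine (rpow_torusNorm_le_of_nonpos hεN (not_lt.1 ht) htd y).trans ?_
    have e1 : -(((-(a : ℤ) : ℤ)) : ℝ) = a := by push_cast; ring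
    rw [e1, Real.rpow_natCast, Nat.floor_natCast, ← pow_mul, mul_comm a]
    gcongr
    linarith

/-- The bound for a kernel on a leg. -/
theorem enorm_kernel_le (hd : 1 ≤ d) {ε t M B δ k : ℝ} (hε : ε ∈ Set.Ioo (0 : ℝ) 1) {N : ℕ}
    (hεN : 1 / 2 ^ (N + 1) ≤ ε) (hB : 0 ≤ B) (hδ : 0 < δ) (htd : -(d : ℝ) + δ ≤ t) (htM : t ≤ M)
    {y : Torus d} (hk : (torusNorm y + ε) ^ (-t) * |k| ≤ B) :
    ‖k‖ₑ ≤ ENNReal.ofReal (B * (2 ^ d + (5 * d : ℝ) ^ M)) * dyadicKernel δ N y := by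
  have hr : 0 < torusNorm y + ε := by linarith [torusNorm_nonneg y, hε.1]
  have hk' := abs_le_of_rpow_mul_le hr hk
  have h5 : (0 : ℝ) ≤ (5 * d : ℝ) ^ M := by positivity
  have h2 : (0 : ℝ) ≤ 2 ^ d := by positivity
  have key : ∀ s ≤ N, ‖y‖ ≤ Real.pi / 2 ^ s →
      (torusNorm y + ε) ^ t ≤ (2 ^ d + (5 * d : ℝ) ^ M) * ((2 : ℝ) ^ ((d : ℝ) - δ)) ^ s →
      ‖k‖ₑ ≤ ENNReal.ofReal (B * (2 ^ d + (5 * d : ℝ) ^ M)) * dyadicKernel δ N y := by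
    intro s hs hy hle
    rw [Real.enorm_eq_ofReal_abs]
    calc ENNReal.ofReal |k| ≤ ENNReal.ofReal (B * (2 ^ d + (5 * d : ℝ) ^ M) *
          ((2 : ℝ) ^ ((d : ℝ) - δ)) ^ s) := by
          refine ENNReal.ofReal_le_ofReal (hk'.trans ?_)
          rw [mul_assoc]
          gcongr
      _ = ENNReal.ofReal (B * (2 ^ d + (5 * d : ℝ) ^ M)) *
          (ENNReal.ofReal (((2 : ℝ) ^ ((d : ℝ) - δ)) ^ s) * ballInd s y) := by
          rw [ballInd_eq_one hy, mul_one, ENNReal.ofReal_mul (by positivity)]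
      _ ≤ _ := by
          gcongr
          exact Finset.single_le_sum
            (f := fun s => ENNReal.ofReal (((2 : ℝ) ^ ((d : ℝ) - δ)) ^ s) * ballInd s y)
            (fun _ _ => zero_le) (Finset.mem_range.2 (by omega))
  rcases le_total 0 t with ht | ht
  · refine key 0 (Nat.zero_le _) (by simpa using norm_le_pi y) ?_
    rw [pow_zero, mul_one]
    linarith [rpow_torusNorm_le_of_nonneg hd hε ht htM y]
  · refine key (scale N y) (scale_le N y) (norm_le_scale N y) ?_
    refine (rpow_torusNorm_le_of_nonpos hεN ht (by linarith) y).trans ?_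
    gcongr
    · linarith
    · norm_num
    · linarith

end Kernel

namespace Diagram

variable {𝔗 : Set ℝ} {V E : Type*} (Γ : Diagram 𝔗 V E) {d : ℕ}

/-- Integrating out one endpoint of each of the edges in `S`, when that endpoint lies on no other
edge in `S`. -/
theorem lintegral_mul_prod_le [Fintype V] {W : Torus d → ℝ≥0∞} (hW : Measurable W)
    (hneg : ∀ y, W (-y) = W y) (S : Finset E) (l : E → V)
    (hl : ∀ e ∈ S, Γ.src e ≠ Γ.tgt e ∧ (l e = Γ.src e ∨ l e = Γ.tgt e))
    (hother : ∀ e ∈ S, ∀ e' ∈ S, e ≠ e' → l e ≠ Γ.src e' ∧ l e ≠ Γ.tgt e')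
    {H : (V → Torus d) → ℝ≥0∞} (hH : Measurable H) (hdep : DependsOn H {v | ∀ e ∈ S, v ≠ l e}) :
    ∫⁻ x, H x * ∏ e ∈ S, W (x (Γ.tgt e) - x (Γ.src e)) ≤ (∫⁻ y, W y) ^ S.card * ∫⁻ x, H x := by
  classical
  induction S using Finset.induction_on with
  | empty => simp
  | insert e S he ih =>
    have ih' := ih (fun e' h => hl e' (Finset.mem_insert_of_mem h))
      (fun e' h e'' h' => hother e' (Finset.mem_insert_of_mem h) e'' (Finset.mem_insert_of_mem h'))
      (fun x y h => hdep fun v hv => h v fun e' he' => hv e' (Finset.mem_insert_of_mem he'))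
    set G : (V → Torus d) → ℝ≥0∞ :=
      fun x => H x * ∏ e ∈ S, W (x (Γ.tgt e) - x (Γ.src e)) with hGdef
    have hG : Measurable G :=
      hH.mul (Finset.measurable_prod _ fun e _ => hW.comp (by fun_prop))
    have hinv : ∀ (a : Torus d) x,
        G (x + fun v => if v ∈ ({l e} : Finset V) then a else 0) = G x := by
      intro a x
      have hx : ∀ v, v ≠ l e →
          (x + fun v => if v ∈ ({l e} : Finset V) then a else 0) v = x v := fun v hv => by
        rw [Pi.add_apply, if_neg (by simpa using hv), add_zero]
      simp only [hGdef]
      congr 1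
      · exact hdep fun v hv => hx v (hv e (Finset.mem_insert_self _ _))
      · refine Finset.prod_congr rfl fun e' he' => ?_
        have hne : e ≠ e' := by rintro rfl; exact he he'
        have h1 := hother e (Finset.mem_insert_self _ _) e' (Finset.mem_insert_of_mem he') hne
        rw [hx _ h1.1.symm, hx _ h1.2.symm]
    have hstep : ∫⁻ x, G x * W (x (Γ.tgt e) - x (Γ.src e)) ≤ (∫⁻ y, W y) * ∫⁻ x, G x := by
      obtain ⟨hne, h | h⟩ := hl e (Finset.mem_insert_self _ _)
      · have h1 := lintegral_mul_sub_le (i := Γ.tgt e) (j := Γ.src e)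
          (by rw [h, Finset.mem_singleton]; exact hne.symm) (by simp [h]) hG hinv hW
        refine le_trans (le_of_eq (lintegral_congr fun x => ?_)) h1
        rw [← hneg, neg_sub]
      · exact lintegral_mul_sub_le
          (by rw [h, Finset.mem_singleton]; exact hne) (by simp [h]) hG hinv hW
    calc _ = ∫⁻ x, G x * W (x (Γ.tgt e) - x (Γ.src e)) := by
          refine lintegral_congr fun x => ?_
          rw [Finset.prod_insert he]
          ring
      _ ≤ (∫⁻ y, W y) * ∫⁻ x, G x := hstep
      _ ≤ (∫⁻ y, W y) * ((∫⁻ y, W y) ^ S.card * ∫⁻ x, H x) := by gcongr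
      _ = _ := by
          rw [Finset.card_insert_of_notMem he]
          ring

open Classical in
/-- A leaf on the leg `e`. -/
def legLeaf (e : E) : V := if Γ.src e ∈ Γ.leaves then Γ.src e else Γ.tgt e

theorem legLeaf_eq (e : E) : Γ.legLeaf e = Γ.src e ∨ Γ.legLeaf e = Γ.tgt e := by
  unfold legLeaf
  split_ifs <;> simp

variable {Γ} in
theorem HasLegs.unique [Fintype E] {k : ℕ} (h : Γ.HasLegs k) {v : V} (hv : v ∈ Γ.leaves) {e e' : E}
    (he : v = Γ.src e ∨ v = Γ.tgt e) (he' : v = Γ.src e' ∨ v = Γ.tgt e') : e = e' := by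
  classical
  have h1 := h.2 v hv
  unfold vertexDegree at h1
  by_contra hne
  have hs : ∀ {f : E → V} {a : E}, v = f a → 0 < (Finset.univ.filter fun a => f a = v).card :=
    fun {f a} h => Finset.card_pos.2 ⟨a, by simp [h]⟩
  have hs2 : ∀ {f : E → V}, v = f e → v = f e' →
      1 < (Finset.univ.filter fun a => f a = v).card :=
    fun {f} h h' => Finset.one_lt_card.2 ⟨e, by simp [h], e', by simp [h'], hne⟩
  rcases he with he | he <;> rcases he' with he' | he'
  · have := hs2 he he'; omega
  · have := hs he; have := hs he'; omega
  · have := hs he; have := hs he'; omega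
  · have := hs2 he he'; omega

variable [Fintype V]

theorem mem_inner {v : V} : v ∈ Γ.inner ↔ v ∉ Γ.leaves := by simp [inner]

variable [Fintype E]

theorem mem_legs {e : E} : e ∈ Γ.legs ↔ Γ.src e ∈ Γ.leaves ∨ Γ.tgt e ∈ Γ.leaves := by
  simp only [legs, Finset.mem_filter, Finset.mem_univ, true_and, mem_innerEdges, mem_inner]
  tauto

theorem legLeaf_mem {e : E} (he : e ∈ Γ.legs) : Γ.legLeaf e ∈ Γ.leaves := by
  unfold legLeaf
  split_ifs with h
  · exact h
  · exact (Γ.mem_legs.1 he).resolve_left h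

variable {Γ} in
theorem HasLegs.src_ne_tgt {k : ℕ} (h : Γ.HasLegs k) {e : E} (he : e ∈ Γ.legs) :
    Γ.src e ≠ Γ.tgt e := by
  classical
  intro heq
  have hv : Γ.src e ∈ Γ.leaves := by
    rcases Γ.mem_legs.1 he with h | h
    · exact h
    · rwa [heq]
  have h1 := h.2 _ hv
  unfold vertexDegree at h1
  have h2 : 0 < (Finset.univ.filter fun e' => Γ.src e' = Γ.src e).card :=
    Finset.card_pos.2 ⟨e, by simp⟩
  have h3 : 0 < (Finset.univ.filter fun e' => Γ.tgt e' = Γ.src e).card :=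
    Finset.card_pos.2 ⟨e, by simp [heq]⟩
  omega

variable {Γ} in
theorem HasLegs.card_legs_le {k : ℕ} (h : Γ.HasLegs k) : Γ.legs.card ≤ 2 * k := by
  rw [← h.1]
  refine Finset.card_le_card_of_injOn Γ.legLeaf (fun e he => Γ.legLeaf_mem he) ?_
  intro e he e' he' heq
  exact h.unique (Γ.legLeaf_mem he) (Γ.legLeaf_eq e) (heq ▸ Γ.legLeaf_eq e')

end Diagram

theorem bddAbove_range_abs_of_isSmooth {d : ℕ} {I : Type*} [Fintype I] {φ : (I → Torus d) → ℝ}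
    (h : IsSmooth φ) : BddAbove (Set.range fun x => |φ x|) := by
  set ψ : (I → Fin d → ℝ) → ℝ :=
    fun y => φ (fun l i => (y l i : AddCircle (2 * Real.pi))) with hψ
  have hc : Continuous fun y => |ψ y| := (ContDiff.continuous h).abs
  have hK : IsCompact (Set.Icc (0 : I → Fin d → ℝ) fun _ _ => 2 * Real.pi) := isCompact_Icc
  refine (hK.bddAbove_image hc.continuousOn).mono ?_
  rintro _ ⟨x, rfl⟩
  have hex : ∀ l i, ∃ r ∈ Set.Ico (0 : ℝ) (0 + 2 * Real.pi), (r : AddCircle (2 * Real.pi)) = x l i :=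
    fun l i => by
      have := AddCircle.coe_image_Ico_eq (2 * Real.pi) 0
      exact (this.symm ▸ Set.mem_univ (x l i) : x l i ∈ _)
  choose r hr hrx using hex
  refine ⟨r, ⟨fun l i => (hr l i).1, fun l i => ?_⟩, ?_⟩
  · have := (hr l i).2
    rw [zero_add] at this
    exact this.le
  · simp only [hψ, hrx]

theorem abs_le_supNorm {d : ℕ} {I : Type*} [Fintype I] {φ : (I → Torus d) → ℝ}
    (h : IsSmooth φ) (x : I → Torus d) : |φ x| ≤ supNorm φ :=
  le_ciSup (bddAbove_range_abs_of_isSmooth h) x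

theorem volume_univ_config {d : ℕ} {V : Type*} [Fintype V] :
    volume (Set.univ : Set (V → Torus d)) =
      ENNReal.ofReal (((2 * Real.pi) ^ d) ^ Fintype.card V) := by
  rw [volume_pi, Measure.pi_univ]
  simp only [volume_pi, Measure.pi_univ, AddCircle.measure_univ, Finset.prod_const,
    Finset.card_univ, Fintype.card_fin]
  rw [ENNReal.ofReal_pow (by positivity), ENNReal.ofReal_pow (by positivity)]

/-- The number of dyadic scales above `ε`. -/
theorem exists_scale_cutoff {ε : ℝ} (hε : ε ∈ Set.Ioo (0 : ℝ) 1) :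
    ∃ N : ℕ, ε ≤ 1 / 2 ^ N ∧ 1 / 2 ^ (N + 1) ≤ ε ∧
      (N : ℝ) + 1 ≤ 3 * max 1 (Real.log (1 / ε)) := by
  have h1 : 1 ≤ 1 / ε := by rw [le_div_iff₀ hε.1]; linarith [hε.2]
  obtain ⟨N, hN1, hN2⟩ := exists_nat_pow_near h1 (one_lt_two (α := ℝ))
  refine ⟨N, ?_, ?_, ?_⟩
  · rw [le_div_iff₀ (by positivity), mul_comm]
    rwa [le_div_iff₀ hε.1] at hN1
  · rw [div_le_iff₀ (by positivity), mul_comm]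
    exact ((div_lt_iff₀ hε.1).1 hN2).le
  · have h2 : Real.log ((2 : ℝ) ^ N) ≤ Real.log (1 / ε) := Real.log_le_log (by positivity) hN1
    rw [Real.log_pow] at h2
    have h3 := Real.log_two_gt_d9
    have h4 := le_max_left 1 (Real.log (1 / ε))
    have h5 := le_max_right 1 (Real.log (1 / ε))
    have h6 : (0 : ℝ) ≤ N := Nat.cast_nonneg _
    nlinarith

namespace Diagram

variable {𝔗 : Set ℝ} {V E : Type*} (Γ : Diagram 𝔗 V E) {d : ℕ}

theorem measurable_weight {K : 𝔗 → ℝ → Torus d → ℝ} {ε : ℝ} (hK : ∀ t, Measurable (K t ε))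
    (S : Finset E) : Measurable (Γ.weight K ε S) := by
  unfold weight
  exact Finset.measurable_prod _ fun e _ => (hK _).comp (by fun_prop)

theorem enorm_weight {K : 𝔗 → ℝ → Torus d → ℝ} {ε : ℝ} (S : Finset E) (x : V → Torus d) :
    ‖Γ.weight K ε S x‖ₑ = ∏ e ∈ S, ‖K (Γ.type e) ε (x (Γ.tgt e) - x (Γ.src e))‖ₑ := by
  simp only [weight, Real.enorm_eq_ofReal_abs, Finset.abs_prod]
  exact ENNReal.ofReal_prod_of_nonneg fun _ _ => abs_nonneg _

variable [Fintype V] [Fintype E]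

theorem card_eq_inner_add {k : ℕ} (h : Γ.HasLegs k) : Fintype.card V = Γ.inner.card + 2 * k := by
  classical
  rw [← h.1, ← Finset.card_univ, add_comm, inner, ← Finset.card_filter_add_card_filter_not
    (s := Finset.univ) (fun v => v ∈ Γ.leaves)]
  congr 2
  ext v; simp

theorem enorm_valTest_le {K : 𝔗 → ℝ → Torus d → ℝ} {ε : ℝ} (hK : ∀ t, Measurable (K t ε))
    {φ : ({v // v ∈ Γ.leaves} → Torus d) → ℝ} (hφ : IsSmooth φ) :
    ‖Γ.valTest K ε φ‖ₑ ≤ ENNReal.ofReal (supNorm φ) *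
      ∫⁻ x, ‖Γ.weight K ε Γ.innerEdges x‖ₑ * ‖Γ.weight K ε Γ.legs x‖ₑ := by
  classical
  set F : (V → Torus d) → ℝ≥0∞ :=
    fun x => ‖Γ.weight K ε Γ.innerEdges x‖ₑ * ‖Γ.weight K ε Γ.legs x‖ₑ with hF
  have hFm : Measurable F :=
    (Γ.measurable_weight hK _).enorm.mul (Γ.measurable_weight hK _).enorm
  set Ψ := MeasurableEquiv.piEquivPiSubtypeProd (fun _ : V => Torus d) (fun v => v ∈ Γ.leaves)
  have hfub : ∫⁻ x, F x = ∫⁻ xL : {v // v ∈ Γ.leaves} → Torus d,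
      ∫⁻ xI : {v // v ∉ Γ.leaves} → Torus d, F (Γ.glue xL xI) := by
    have hmp := (volume_preserving_piEquivPiSubtypeProd (fun _ : V => Torus d)
      (fun v => v ∈ Γ.leaves)).symm
    rw [← hmp.lintegral_comp hFm, Measure.volume_eq_prod, lintegral_prod]
    · rw [Subsingleton.elim (Finset.Subtype.fintype Γ.leaves)
        (Subtype.fintype fun v => v ∈ Γ.leaves)]
      rfl
    · exact (hFm.comp Ψ.symm.measurable).aemeasurable
  rw [hfub, ← lintegral_const_mul' _ _ ENNReal.ofReal_ne_top]
  refine (enorm_integral_le_lintegral_enorm _).trans (lintegral_mono fun xL => ?_)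
  rw [enorm_mul, mul_comm]
  refine mul_le_mul' ?_ ?_
  · rw [Real.enorm_eq_ofReal_abs]
    exact ENNReal.ofReal_le_ofReal (abs_le_supNorm hφ xL)
  · refine (enorm_integral_le_lintegral_enorm _).trans (le_of_eq (lintegral_congr fun xI => ?_))
    rw [enorm_mul]

/-- Integrating out the leaves. -/
theorem lintegral_weight_legs_le {k : ℕ} (hk : Γ.HasLegs k) {K : 𝔗 → ℝ → Torus d → ℝ} {ε : ℝ}
    (hK : ∀ t, Measurable (K t ε)) {W : Torus d → ℝ≥0∞} (hW : Measurable W)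
    (hneg : ∀ y, W (-y) = W y) (hKW : ∀ t y, ‖K t ε y‖ₑ ≤ W y) :
    ∫⁻ x, ‖Γ.weight K ε Γ.innerEdges x‖ₑ * ‖Γ.weight K ε Γ.legs x‖ₑ ≤
      (∫⁻ y, W y) ^ Γ.legs.card * ∫⁻ x, ‖Γ.weight K ε Γ.innerEdges x‖ₑ := by
  have h1 : ∀ x, ‖Γ.weight K ε Γ.innerEdges x‖ₑ * ‖Γ.weight K ε Γ.legs x‖ₑ ≤
      ‖Γ.weight K ε Γ.innerEdges x‖ₑ * ∏ e ∈ Γ.legs, W (x (Γ.tgt e) - x (Γ.src e)) := fun x => by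
    rw [Γ.enorm_weight Γ.legs]
    gcongr with e
    exact hKW _ _
  refine (lintegral_mono h1).trans (Γ.lintegral_mul_prod_le hW hneg Γ.legs Γ.legLeaf
    (fun e he => ⟨hk.src_ne_tgt he, Γ.legLeaf_eq e⟩) ?_ (Γ.measurable_weight hK _).enorm ?_)
  · intro e he e' _ hne
    constructor <;> intro heq
    · exact hne (hk.unique (Γ.legLeaf_mem he) (Γ.legLeaf_eq e) (Or.inl heq))
    · exact hne (hk.unique (Γ.legLeaf_mem he) (Γ.legLeaf_eq e) (Or.inr heq))
  · intro x y h
    have hxy : ∀ v ∈ Γ.inner, x v = y v := fun v hv => h v fun e he heq =>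
      Γ.mem_inner.1 hv (heq ▸ Γ.legLeaf_mem he)
    have : Γ.weight K ε Γ.innerEdges x = Γ.weight K ε Γ.innerEdges y :=
      Finset.prod_congr rfl fun e he => by
        rw [hxy _ (Γ.mem_innerEdges.1 he).1, hxy _ (Γ.mem_innerEdges.1 he).2]
    simp only [this]

/-- Hepp's bound for the integral over the inner vertices. -/
theorem lintegral_weight_inner_le {k : ℕ} (hk : Γ.HasLegs k) (hne : Γ.inner.Nonempty)
    (hΓ : Γ.NonNegative d) (hZ : Γ.IntegerTypes) {K : 𝔗 → ℝ → Torus d → ℝ} {ε L C : ℝ}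
    (hε : 0 ≤ ε) {N : ℕ} (hεN : ε ≤ 1 / 2 ^ N) (hL : 1 ≤ L) (hN : (N : ℝ) + 1 ≤ 3 * L)
    (hC : 0 ≤ C)
    (hKC : ∀ x : V → Torus d, ∀ e ∈ Γ.innerEdges, |K (Γ.type e) ε (x (Γ.tgt e) - x (Γ.src e))| ≤
      C * (2 ^ (Γ.edgeScale N x e * Γ.negPart e) * Γ.posFactor ε x e)) :
    ∫⁻ x, ‖Γ.weight K ε Γ.innerEdges x‖ₑ ≤
      ENNReal.ofReal ((24 * ((2 * Real.pi) ^ d) ^ 2) ^ Γ.inner.card *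
        (2 * C) ^ Γ.innerEdges.card * ((2 * Real.pi) ^ d) ^ (2 * k) *
          ∑ T ∈ heppTrees Γ.inner, L ^ Γ.null d T) := by
  classical
  set κ : ℝ := (2 * Real.pi) ^ d with hκ
  have hκ1 : 1 ≤ κ := one_le_pow₀ (by linarith [Real.pi_gt_three])
  have hex : ∀ F ∈ heppTrees Γ.inner, ∃ T : BinTree V, T.labels = Γ.inner.val ∧ T.clusters = F :=
    fun F hF => (Finset.mem_filter.1 hF).2
  have : Nonempty (BinTree V) := ⟨.leaf hne.choose⟩
  choose! tree hlab hclus using hex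
  have hsupp : ∀ T : BinTree V, T.labels = Γ.inner.val → T.support = Γ.inner := fun T hT => by
    ext v; rw [BinTree.mem_support, hT, Finset.mem_val]
  have hnd : ∀ T : BinTree V, T.labels = Γ.inner.val → T.labels.Nodup :=
    fun T hT => hT ▸ Γ.inner.nodup
  have hpt : ∀ x : V → Torus d, ‖Γ.weight K ε Γ.innerEdges x‖ₑ ≤
      ENNReal.ofReal (C ^ Γ.innerEdges.card) *
        ∑ F ∈ heppTrees Γ.inner, Γ.majorant N (tree F) 0 x := by
    intro x
    obtain ⟨T, hT, hl⟩ := Γ.exists_linked (s := Γ.edgeScale N x) (N := N)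
      (fun e => scale_le N _) hne
    have h1 := hl.prod_le_majorant hΓ hZ hε hεN (hnd T hT) (hsupp T hT).le
    rw [hsupp T hT, edgesIn_inner] at h1
    have hmem : T.clusters ∈ heppTrees Γ.inner := by
      refine Finset.mem_filter.2 ⟨?_, T, hT, rfl⟩
      rw [Finset.mem_powerset]
      intro u hu
      rw [Finset.mem_powerset, ← hsupp T hT]
      exact (BinTree.clusters_prop hu).1
    have heq : T.SwapEquiv (tree T.clusters) :=
      BinTree.swapEquiv_of_clusters_eq (hnd T hT) (hnd _ (hlab _ hmem))
        (by rw [hsupp T hT, hsupp _ (hlab _ hmem)]) (hclus _ hmem).symm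
    rw [Γ.majorant_congr N heq] at h1
    have h2 : |Γ.weight K ε Γ.innerEdges x| ≤ C ^ Γ.innerEdges.card *
        ∏ e ∈ Γ.innerEdges, 2 ^ (Γ.edgeScale N x e * Γ.negPart e) * Γ.posFactor ε x e := by
      rw [weight, Finset.abs_prod, ← Finset.prod_const, ← Finset.prod_mul_distrib]
      exact Finset.prod_le_prod (fun _ _ => abs_nonneg _) (hKC x)
    rw [Real.enorm_eq_ofReal_abs]
    refine (ENNReal.ofReal_le_ofReal h2).trans ?_
    rw [ENNReal.ofReal_mul (by positivity)]
    gcongr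
    exact h1.trans (Finset.single_le_sum (f := fun F => Γ.majorant N (tree F) 0 x)
      (fun _ _ => zero_le) hmem)
  have hintg : ∀ F ∈ heppTrees Γ.inner, ∫⁻ x : V → Torus d, Γ.majorant N (tree F) 0 x ≤
      ENNReal.ofReal ((24 * κ) ^ Γ.inner.card * 2 ^ Γ.innerEdges.card * L ^ Γ.null d F *
        κ ^ Fintype.card V) := by
    intro F hF
    have h1 := Γ.lintegral_mul_majorant_le (d := d) N (hnd _ (hlab F hF)) 0
      (H := fun _ => 1) measurable_const (fun _ _ _ => rfl)
    simp only [one_mul, lintegral_const, volume_univ_config, ← hκ] at h1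
    refine h1.trans ?_
    rw [← ENNReal.ofReal_mul (Γ.treeSum_nonneg d (by linarith) N _ _)]
    refine ENNReal.ofReal_le_ofReal ?_
    gcongr
    refine (Γ.treeSum_le hΓ hZ hκ1 hL hN (hnd _ (hlab F hF)) (hsupp _ (hlab F hF)).le 0).trans ?_
    have hcard := BinTree.card_support (hnd _ (hlab F hF))
    rw [hsupp _ (hlab F hF)] at hcard
    have h2 := Γ.posConst_le (tree F)
    rw [hsupp _ (hlab F hF)] at h2
    rw [hsupp _ (hlab F hF), edgesIn_inner, hclus F hF, Nat.cast_zero, neg_zero, zero_mul,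
      zpow_zero, mul_one]
    have h3 : (3 * κ) ^ (tree F).nodes ≤ (3 * κ) ^ Γ.inner.card :=
      pow_le_pow_right₀ (by linarith) (by omega)
    have h4 : (24 * κ) ^ Γ.inner.card = 8 ^ Γ.inner.card * (3 * κ) ^ Γ.inner.card := by
      rw [← mul_pow]; ring_nf
    rw [h4]
    gcongr
  refine (lintegral_mono hpt).trans ?_
  rw [lintegral_const_mul _ (Finset.measurable_sum _ fun F _ => Γ.measurable_majorant N _ 0),
    lintegral_finsetSum _ fun F _ => Γ.measurable_majorant N _ 0]
  refine (mul_le_mul_right (Finset.sum_le_sum hintg) _).trans (le_of_eq ?_)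
  rw [← ENNReal.ofReal_sum_of_nonneg fun F _ => by positivity,
    ← ENNReal.ofReal_mul (by positivity), ← Finset.sum_mul, ← Finset.mul_sum,
    Γ.card_eq_inner_add hk, pow_add, mul_pow 2 C, mul_pow 24 (κ ^ 2), mul_pow 24 κ,
    ← pow_mul κ 2, two_mul Γ.inner.card, pow_add κ]
  congr 1
  ring

end Diagram

end Feynman

end

open Feynman MeasureTheory in
theorem proposition4p1
    (d : ℕ) (hd : 1 ≤ d)
    (𝔗 : Set ℝ)
    (h𝔗_lower : ∃ δ : ℝ, 0 < δ ∧ ∀ t ∈ 𝔗, -(d : ℝ) + δ ≤ t)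
    (h𝔗_upper : BddAbove 𝔗)
    (K : 𝔗 → ℝ → Feynman.Torus d → ℝ)
    (hK_meas : ∀ t : 𝔗, ∀ ε ∈ Set.Ioo (0 : ℝ) 1, Measurable (K t ε))
    (hK_bound : ∃ B : ℝ, ∀ t : 𝔗, ∀ ε ∈ Set.Ioo (0 : ℝ) 1, ∀ x : Feynman.Torus d,
      (Feynman.torusNorm x + ε) ^ (-(t : ℝ)) * |K t ε x| ≤ B) :
    ∃ C : ℝ, 0 < C ∧
      ∀ (V E : Type) [Fintype V] [Fintype E] (Γ : Feynman.Diagram 𝔗 V E) (k : ℕ),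
        Γ.HasLegs k → Γ.inner.Nonempty → Γ.NonNegative d →
        (∀ e ∈ Γ.innerEdges, ∃ n : ℤ, (Γ.type e : ℝ) = n) →
        ∀ ε ∈ Set.Ioo (0 : ℝ) 1, ∀ φ : ({v // v ∈ Γ.leaves} → Feynman.Torus d) → ℝ,
          Feynman.IsSmooth φ →
          |Γ.valTest K ε φ| ≤
            Feynman.supNorm φ * C ^ (Γ.inner.card + Γ.innerEdges.card + 2 * k) *
              ∑ T ∈ Feynman.heppTrees Γ.inner,
                (max 1 (Real.log (1 / ε))) ^ Γ.null d T := by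
  obtain ⟨δ, hδ, hlow⟩ := h𝔗_lower
  obtain ⟨M, hM⟩ := h𝔗_upper
  obtain ⟨B₀, hB₀⟩ := hK_bound
  set B : ℝ := max B₀ 1 with hBdef
  have hB1 : 1 ≤ B := le_max_right _ _
  have hB0 : 0 ≤ B := by linarith
  have hB : ∀ t : 𝔗, ∀ ε ∈ Set.Ioo (0 : ℝ) 1, ∀ x : Torus d,
      (torusNorm x + ε) ^ (-(t : ℝ)) * |K t ε x| ≤ B :=
    fun t ε hε x => (hB₀ t ε hε x).trans (le_max_left _ _)
  set κ : ℝ := (2 * Real.pi) ^ d with hκ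
  have hκ1 : 1 ≤ κ := one_le_pow₀ (by linarith [Real.pi_gt_three])
  set C₁ : ℝ := B * (2 ^ d + (5 * d : ℝ) ^ M) with hC₁
  have hC₁1 : 1 ≤ C₁ := by
    have h2 : (1 : ℝ) ≤ 2 ^ d := one_le_pow₀ one_le_two
    have h5 : (0 : ℝ) ≤ (5 * d : ℝ) ^ M := by positivity
    exact one_le_mul_of_one_le_of_one_le hB1 (by linarith)
  set c : ℝ := κ * (1 - (2 : ℝ) ^ (-δ))⁻¹ with hc
  have hc1 : 1 ≤ c := by
    have hr0 : (0 : ℝ) ≤ (2 : ℝ) ^ (-δ) := by positivity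
    have hr1 : (2 : ℝ) ^ (-δ) < 1 := Real.rpow_lt_one_of_one_lt_of_neg one_lt_two (by linarith)
    exact one_le_mul_of_one_le_of_one_le hκ1 ((one_le_inv₀ (by linarith)).2 (by linarith))
  have ha1 : 1 ≤ 24 * κ ^ 2 := by nlinarith
  have hb1 : 1 ≤ 2 * C₁ := by linarith
  have hl1 : 1 ≤ C₁ * c * κ :=
    one_le_mul_of_one_le_of_one_le (one_le_mul_of_one_le_of_one_le hC₁1 hc1) hκ1
  refine ⟨24 * κ ^ 2 * (2 * C₁) * (C₁ * c * κ), by positivity, ?_⟩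
  intro V E _ _ Γ k hk hne hΓ hZ ε hε φ hφ
  obtain ⟨N, hεN, hεN', hN⟩ := exists_scale_cutoff hε
  set L := max 1 (Real.log (1 / ε)) with hL
  set S := ∑ T ∈ heppTrees Γ.inner, L ^ Γ.null d T with hS
  have hL1 : 1 ≤ L := le_max_left _ _
  have hS0 : 0 ≤ S := Finset.sum_nonneg fun T _ => by positivity
  have hsup : 0 ≤ supNorm φ := Real.iSup_nonneg fun x => abs_nonneg _
  have hmeas : ∀ t, Measurable (K t ε) := fun t => hK_meas t ε hε
  have h1 := Γ.enorm_valTest_le hmeas hφ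
  have h2 := Γ.lintegral_weight_legs_le hk hmeas
    (W := fun y => ENNReal.ofReal C₁ * dyadicKernel δ N y)
    ((measurable_dyadicKernel δ N).const_mul _) (fun y => by rw [dyadicKernel_neg])
    (fun t y => enorm_kernel_le hd hε hεN' hB0 hδ (hlow t t.2) (hM t.2) (hB t ε hε y))
  have h3 := Γ.lintegral_weight_inner_le hk hne hΓ hZ (K := K) hε.1.le hεN hL1 hN
    (by linarith : 0 ≤ C₁) (fun x e he => abs_kernel_le_of_int hd hε hεN' hB0
      (by linarith [hlow _ (Γ.type e).2]) (hM (Γ.type e).2) (hZ e he) (hB _ ε hε _))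
  have h4 : (∫⁻ y : Torus d, ENNReal.ofReal C₁ * dyadicKernel δ N y) ^ Γ.legs.card ≤
      ENNReal.ofReal ((C₁ * c) ^ (2 * k)) := by
    have h5 : ∫⁻ y : Torus d, ENNReal.ofReal C₁ * dyadicKernel δ N y ≤
        ENNReal.ofReal (C₁ * c) := by
      rw [lintegral_const_mul _ (measurable_dyadicKernel δ N), ENNReal.ofReal_mul
        (p := C₁) (by linarith)]
      exact mul_le_mul' le_rfl (lintegral_dyadicKernel_le hδ N)
    calc _ ≤ ENNReal.ofReal (C₁ * c) ^ Γ.legs.card := by gcongr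
      _ = ENNReal.ofReal ((C₁ * c) ^ Γ.legs.card) := by rw [ENNReal.ofReal_pow (by positivity)]
      _ ≤ _ := by
        refine ENNReal.ofReal_le_ofReal (pow_le_pow_right₀ ?_ hk.card_legs_le)
        exact one_le_mul_of_one_le_of_one_le hC₁1 hc1
  have h5 : ‖Γ.valTest K ε φ‖ₑ ≤ ENNReal.ofReal (supNorm φ * ((C₁ * c) ^ (2 * k) *
      ((24 * κ ^ 2) ^ Γ.inner.card * (2 * C₁) ^ Γ.innerEdges.card * κ ^ (2 * k) * S))) := by
    rw [ENNReal.ofReal_mul hsup, ENNReal.ofReal_mul (by positivity)]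
    exact h1.trans (mul_le_mul' le_rfl (h2.trans (mul_le_mul' h4 h3)))
  rw [Real.enorm_eq_ofReal_abs, ENNReal.ofReal_le_ofReal_iff (by positivity)] at h5
  refine h5.trans ?_
  rw [mul_assoc (supNorm φ)]
  refine mul_le_mul_of_nonneg_left ?_ hsup
  calc _ = ((24 * κ ^ 2) ^ Γ.inner.card * (2 * C₁) ^ Γ.innerEdges.card *
        (C₁ * c * κ) ^ (2 * k)) * S := by rw [mul_pow (C₁ * c) κ]; ring
    _ ≤ _ := by
      refine mul_le_mul_of_nonneg_right ?_ hS0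
      rw [mul_pow _ (C₁ * c * κ), mul_pow _ (2 * C₁)]
      exact mul_le_mul (mul_le_mul (pow_le_pow_right₀ ha1 (by omega))
        (pow_le_pow_right₀ hb1 (by omega)) (by positivity) (by positivity))
        (pow_le_pow_right₀ hl1 (by omega)) (by positivity) (by positivity)
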